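/- Let $W$ be a probability distribution on $\mathbb Z$, let $\xi_1,\xi_2,\dots$ be IID steps with law $W$, and put $\hat W(\varphi)=\mathbb E\,e^{-i\varphi\xi_1}$. Let $\psi$ be a probability distribution on $\{1,2,\dots\}$, with generating function $\bar\psi(u)=\sum_{t\ge1}\psi(t)u^t$, and let $N(t)=\max\{n\ge 0: J_n\le t\}$ be the renewal counting process whose renewal times $J_n$ are sums of $n$ IID waiting times with law $\psi$. For $p\in(0,1)$ and $q=1-p$ let $T$ be geometric, $\mathbb P[T=t]=pq^{t-1}$ ($t\ge1$); steps, waiting times and $T$ are independent. Let $M(t)=N(t)$ for $t<T$, $M(t)=N(T)$ for $t\ge T$, $M(\infty)=N(T)$, and let $X_t=\sum_{r=1}^{M(t)}\xi_r$, $P(x,t)=\mathbb P[X_t=x]$ and $$P(x,\infty)=\lim_{t\to\infty}P(x,t),\qquad P_q(x,\infty)=\frac{1-\bar\psi(q)}{2\pi}\int_{-\pi}^{\pi}\frac{e^{i\varphi x}}{1-\hat W(\varphi)\bar\psi(q)}\,d\varphi ,\qquad x\in\mathbb Z .$$ The limit exists, $P(\cdot,\infty)$ is a probability distribution on $\mathbb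 Z$, and $P(x,\infty)=\frac1qP_q(x,\infty)-\frac pq\delta_{x,0}$. For $\alpha\in(0,2]$, real $\theta$ and $c>0$ write $(i^\theta k)^\alpha=|k|^\alpha e^{\frac{\pi i}{2}\mathrm{sgn}(k)\alpha\theta}$ and $\mathcal L_\alpha(y)=\frac1{2\pi}\int_{-\infty}^\infty e^{iky}e^{-c(i^\theta k)^\alpha}\,dk$. Let $\lambda=\lambda(p)$ be any function with $\lambda(p)\sim\mathbb E M(\infty)$ as $p\to0^+$. "The rescaled propagators converge weakly to $\mu$ at index $\alpha$" means that for every such $\psi$, every such $\lambda$ and every bounded continuous $f:\mathbb R\to\mathbb R$, as $p\to0^+$, $$\sum_{x\in\mathbb Z}P(x,\infty)f(x\lambda^{-1/\alpha})\to\int f\,d\mu\quad\text{and}\quad\sum_{x\in\mathbb Z}P_q(x,\infty)f(x\lambda^{-1/\alpha})\to\int f\,d\mu .$$ In particular $\mu$ does not depend on the stopped renewal process. **Proposition (NESS).** Suppose $\hat W(\varphi)=1-c(i^\theta\varphi)^\alpha+o(|\varphi|^\alpha)$ as $\varphi\to0$, with $\alpha\in(0,2]$, $\theta\in\mathbb R$,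 $c>0$. Then there is a probability measure $\nu$ on $\mathbb R$ with $\int e^{-iky}\,\nu(dy)=e^{-c(i^\theta k)^\alpha}$ for all real $k$; it is strictly $\alpha$-stable (if $Y,Y'$ are independent with law $\nu$, then $a^{1/\alpha}Y+b^{1/\alpha}Y'$ has the law of $(a+b)^{1/\alpha}Y$ for all $a,b>0$); and at index $\alpha$ the rescaled propagators converge weakly to the law $P_c$ of $\tau^{1/\alpha}Y$, where $Y$ has law $\nu$ and $\tau$ is an independent exponential variable of mean $1$. Moreover: 1. Except when $\alpha=1$ and $\cos(\pi\theta/2)=0$, $\mathcal L_\alpha\ge0$ is the density of $\nu$, and $P_c$ has the density $$P_c(y)=\int_0^\infty e^{-\tau}\tau^{-1/\alpha}\mathcal L_\alpha(y\tau^{-1/\alpha})\,d\tau ,$$ the integral being convergent for all $y\ne0$, and also for $y=0$ if $\alpha>1$. If moreover $\alpha>1$ and the support of $W$ generates the group $\mathbb Z$, then, for every $\psi$ and $\lambda$ as above, $\lambda^{1/\alpha}P(x,\infty)-P_c(x\lambda^{-1/\alpha})\to0$ and $\lambda^{1/\alpha}P_q(x,\infty)-P_c(x\lambda^{-1/\alpha})\to0$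 as $p\to0^+$, uniformly in $x\in\mathbb Z$. 2. If $\alpha=1$ and $\cos(\pi\theta/2)=0$, then with $A=c\sin(\pi\theta/2)$ one has $\nu=\delta_A$, and $P_c$ has the one-sided exponential density $\frac1{|A|}e^{-y/A}$ on $\{y: y/A\ge0\}$ (and $0$ elsewhere). Special cases: * (Biased steps.) If $\mathbb E|\xi_1|<\infty$ and $A=\mathbb E\xi_1\neq0$, the expansion holds with $\alpha=1$, $\theta=\mathrm{sgn}(A)$, $c=|A|$, and at index $1$ the rescaled propagators converge weakly to the law with density $\frac1{|A|}e^{-y/A}$ on $\{y/A\ge0\}$. * (Unbiased steps.) If $\mathbb E\xi_1=0$ and $0<B=\mathbb E\xi_1^2<\infty$, the expansion holds with $\alpha=2$, $\theta=0$, $c=B/2$; $\mathcal L_2$ is the centred Gaussian density with variance $B$, $\int_0^\infty e^{-\tau}\tau^{-1/2}\mathcal L_2(y\tau^{-1/2})\,d\tau=\frac{1}{\sqrt{2B}}e^{-|y|\sqrt{2/B}}$ for all real $y$, and at index $2$ the rescaled propagators converge weakly to this Laplace law. -/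

import Mathlib

open MeasureTheory ProbabilityTheory Filter Asymptotics
open scoped Topology

namespace StoppedWalk

noncomputable section

/-! ## The stopped renewal process and the walk generated by it -/

/-- Renewal times `J_n = Δt_1 + ⋯ + Δt_n` (the `j`-th waiting time is `Δ (j - 1)`). -/
def renewalTime (Δ : ℕ → ℕ) (n : ℕ) : ℕ := ∑ j ∈ Finset.range n, Δ j

/-- The renewal counting process `N(t) = max {n | J_n ≤ t}`. For waiting times that are at least `1`
the set is finite and contains `0`, so that the supremum is a maximum. -/
def renewalCount (Δ : ℕ → ℕ) (t : ℕ) : ℕ := sSup {n : ℕ | renewalTime Δ n ≤ t}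

/-- The arrival process stopped at the time `T`: `M(t) = N(t)` for `t < T` and `M(t) = N(T)` for
`t ≥ T`. -/
def stoppedCount (Δ : ℕ → ℕ) (T t : ℕ) : ℕ :=
  if t < T then renewalCount Δ t else renewalCount Δ T

/-- The position `X_t = ξ_1 + ⋯ + ξ_{M(t)}` of the walker. -/
def position (Δ : ℕ → ℕ) (T : ℕ) (ξ : ℕ → ℤ) (t : ℕ) : ℤ :=
  ∑ j ∈ Finset.range (stoppedCount Δ T t), ξ j

/-- The geometric law `P[T = t] = p (1 - p) ^ (t - 1)`, `t = 1, 2, …`, of the first arrival time of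
a standard Bernoulli process with success probability `p`. -/
def stoppingLaw (p : ℝ) : Measure ℕ :=
  Measure.sum fun t : ℕ => ENNReal.ofReal (p * (1 - p) ^ t) • Measure.dirac (t + 1)

/-- The joint law of the IID waiting times with law `ψ` and of the independent geometric
stopping time. -/
def timeMeasure (ψ : PMF ℕ) (p : ℝ) : Measure ((ℕ → ℕ) × ℕ) :=
  (Measure.infinitePi fun _ : ℕ => ψ.toMeasure).prod (stoppingLaw p)

/-- The joint law of waiting times and stopping time, and of the IID steps with law `W`, which are
independent of them. -/
def walkMeasure (ψ : PMF ℕ) (W : PMF ℤ) (p : ℝ) : Measure (((ℕ → ℕ) × ℕ) × (ℕ → ℤ)) :=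
  (timeMeasure ψ p).prod (Measure.infinitePi fun _ : ℕ => W.toMeasure)

/-- The propagator `P(x, t) = P[X_t = x]`. -/
def propagator (ψ : PMF ℕ) (W : PMF ℤ) (p : ℝ) (t : ℕ) (x : ℤ) : ℝ :=
  (walkMeasure ψ W p).real {ω | position ω.1.1 ω.1.2 ω.2 t = x}

/-- The infinite-time propagator `P(x, ∞) = lim_{t → ∞} P(x, t)`. -/
def infinitePropagator (ψ : PMF ℕ) (W : PMF ℤ) (p : ℝ) (x : ℤ) : ℝ :=
  limUnder atTop fun t : ℕ => propagator ψ W p t x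

/-- The expected final number of arrivals `E M(∞) = E N(T)`. -/
def expectedFinalCount (ψ : PMF ℕ) (p : ℝ) : ℝ :=
  ∫ ω, (renewalCount ω.1 ω.2 : ℝ) ∂(timeMeasure ψ p)

/-- The generating function of the waiting times. -/
def waitingGF (ψ : PMF ℕ) (u : ℝ) : ℝ := ∑' t : ℕ, (ψ t).toReal * u ^ t

/-- The characteristic function `Ŵ(φ) = E exp(-i φ ξ)` of the steps. -/
def stepCharFun (W : PMF ℤ) (φ : ℝ) : ℂ :=
  ∑' x : ℤ, ((W x).toReal : ℂ) * Complex.exp (-(Complex.I * φ * x))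

/-- The auxiliary propagator `P_q(x, ∞)`, `q = 1 - p`, as a Fourier integral. -/
def auxPropagator (ψ : PMF ℕ) (W : PMF ℤ) (p : ℝ) (x : ℤ) : ℂ :=
  ((1 - waitingGF ψ (1 - p) : ℝ) : ℂ) / (2 * Real.pi) *
    ∫ φ in (-Real.pi)..Real.pi,
      Complex.exp (Complex.I * φ * x) / (1 - stepCharFun W φ * (waitingGF ψ (1 - p) : ℂ))

/-! ## Stable laws and the limiting steady state -/

/-- `(i^θ k)^α = |k|^α exp (i (π / 2) sgn(k) α θ)`. -/
def stableExponent (α θ k : ℝ) : ℂ :=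
  ((|k| ^ α : ℝ) : ℂ) * Complex.exp (Complex.I * ((Real.pi / 2 * Real.sign k * α * θ : ℝ) : ℂ))

/-- The expansion `Ŵ(φ) = 1 - c (i^θ φ)^α + o(|φ|^α)` as `φ → 0`. -/
def StepExpansion (W : PMF ℤ) (α θ c : ℝ) : Prop :=
  (fun φ : ℝ => stepCharFun W φ - (1 - (c : ℂ) * stableExponent α θ φ))
    =o[𝓝 0] fun φ : ℝ => |φ| ^ α

/-- The function `L_α(y) = (2π)⁻¹ ∫ exp (i k y) exp (-c (i^θ k)^α) dk`. The integral is real, since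
the values of the integrand at `k` and `-k` are complex conjugates. -/
def stableDensity (α θ c y : ℝ) : ℝ :=
  (1 / (2 * (Real.pi : ℂ)) *
    ∫ k : ℝ, Complex.exp (Complex.I * k * y) * Complex.exp (-((c : ℂ) * stableExponent α θ k))).re

/-- `ν` is (strictly) stable with index `α`: if `Y, Y'` are independent with law `ν`, then
`a^{1/α} Y + b^{1/α} Y'` and `(a + b)^{1/α} Y` have the same law, for all `a, b > 0`. -/
def IsStable (α : ℝ) (ν : Measure ℝ) : Prop :=
  ∀ a b : ℝ, 0 < a → 0 < b →
    Measure.conv (ν.map fun y => a ^ (1 / α) * y) (ν.map fun y => b ^ (1 / α) * y)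
      = ν.map fun y => (a + b) ^ (1 / α) * y

/-- `P_c(y) = ∫₀^∞ exp (-τ) τ^{-1/α} L(y τ^{-1/α}) dτ` for a density `L`. -/
def nessDensity (α : ℝ) (L : ℝ → ℝ) (y : ℝ) : ℝ :=
  ∫ τ in Set.Ioi (0 : ℝ), Real.exp (-τ) * τ ^ (-(1 / α)) * L (y * τ ^ (-(1 / α)))

/-- The same superposition for an arbitrary law `ν`: the mixture, with weight `exp (-τ) dτ` on
`(0, ∞)`, of the laws of `τ^{1/α} Y`, where `Y` has law `ν`. -/
def nessLaw (α : ℝ) (ν : Measure ℝ) : Measure ℝ :=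
  ((expMeasure 1).prod ν).map fun z : ℝ × ℝ => z.1 ^ (1 / α) * z.2

/-- The measure on `ℝ` with density `g`. -/
def lawOfDensity (g : ℝ → ℝ) : Measure ℝ := volume.withDensity fun y => ENNReal.ofReal (g y)

/-- The one-sided exponential density `|A|⁻¹ Θ(y / A) exp (-y / A)`. -/
def exponentialDensity (A y : ℝ) : ℝ := if 0 ≤ y / A then 1 / |A| * Real.exp (-(y / A)) else 0

/-- The Laplace density `exp (-|y| √(2 / B)) / √(2 B)`. -/
def laplaceDensity (B y : ℝ) : ℝ := Real.exp (-(|y| * √(2 / B))) / √(2 * B)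

/-- Admissible scalings: `s(p) ∼ E M(∞)` as `p → 0+`. -/
def IsScaling (ψ : PMF ℕ) (s : ℝ → ℝ) : Prop :=
  s ~[𝓝[>] 0] fun p => expectedFinalCount ψ p

/-- The rescaled infinite-time propagators `P(·, ∞)` and `P_q(·, ∞)`, put on the lattice
`s^{-1/α} ℤ`, both converge weakly to `μ` as `p → 0+`, whatever the stopped renewal process (with
waiting time law `ψ` on `{1, 2, …}`) and whatever the admissible scaling. -/
def ConvergesToNESS (W : PMF ℤ) (α : ℝ) (μ : Measure ℝ) : Prop :=
  ∀ ψ : PMF ℕ, ψ 0 = 0 → ∀ s : ℝ → ℝ, IsScaling ψ s →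
    ∀ f : BoundedContinuousFunction ℝ ℝ,
      Tendsto (fun p => ∑' x : ℤ, infinitePropagator ψ W p x * f (x / s p ^ (1 / α)))
        (𝓝[>] 0) (𝓝 (∫ y, f y ∂μ)) ∧
      Tendsto (fun p => ∑' x : ℤ, auxPropagator ψ W p x * (f (x / s p ^ (1 / α)) : ℂ))
        (𝓝[>] 0) (𝓝 ((∫ y, f y ∂μ : ℝ) : ℂ))

/-- Convergence of densities: `s^{1/α} P(x, ∞)` and `s^{1/α} P_q(x, ∞)` are uniformly close to
`g (x / s^{1/α})` as `p → 0+`, whatever the stopped renewal process and the admissible scaling. -/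
def ConvergesLocally (W : PMF ℤ) (α : ℝ) (g : ℝ → ℝ) : Prop :=
  ∀ ψ : PMF ℕ, ψ 0 = 0 → ∀ s : ℝ → ℝ, IsScaling ψ s →
    ∀ ε : ℝ, 0 < ε → ∀ᶠ p in 𝓝[>] (0 : ℝ), ∀ x : ℤ,
      |s p ^ (1 / α) * infinitePropagator ψ W p x - g (x / s p ^ (1 / α))| ≤ ε ∧
      ‖((s p ^ (1 / α) : ℝ) : ℂ) * auxPropagator ψ W p x - (g (x / s p ^ (1 / α)) : ℂ)‖ ≤ ε

end

end StoppedWalk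

open StoppedWalk

namespace StoppedWalk

/-! ## The final number of arrivals -/

/-! Everything rests on one explicit generating function. Write $q=1-p$ and $g=\bar\psi(q)$. Since
$n<N(T)$ means $J_{n+1}\le T$ and $T$ is geometric, $P[n<N(T)]=E\,q^{J_{n+1}-1}=g^{n+1}/q$. Summing
over $n$ gives $E\,z^{N(T)}=\frac1q\bigl(\frac{1-g}{1-zg}-p\bigr)$ for $|z|\le1$, and
$E\,N(T)=\frac{g}{q(1-g)}$. At $z=\hat W(\varphi)$ this is the characteristic function of the final
position (`integral_cexp_finalLaw`), and Fourier inversion on the integers turns it into the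
relation between $P$ and $P_q$.

As $p\to0^+$, $g\to1$ and $\lambda(1-g)\to1$, so at frequency $k\lambda^{-1/\alpha}$ the quotient
$\frac{1-g}{1-\hat Wg}$ tends to $1/(1+c(i^\theta k)^\alpha)$: the process enters only through
$\lambda(1-g)$, which is why the limit is universal. Since $\int_0^\infty e^{-\tau}e^{-\tau
z}d\tau=1/(1+z)$, the limit is the characteristic function of $\tau^{1/\alpha}Y$
(`charFun_nessLaw`), and continuity of characteristic functions gives weak convergence.

The stable law $\nu$ is obtained from the walk itself, as the limit of $S_n/n^{1/\alpha}$ with the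
help of tightness. Its existence then constrains the parameters: $\cos(\pi\alpha\theta/2)\ge0$
because a characteristic function is bounded by one, and the cosine vanishes only if $\alpha=1$,
because a characteristic function of modulus one obeys a doubling rule that forces $2^\alpha=2$. In
that exceptional case $\nu$ is a point mass. Otherwise the characteristic function decays like
$e^{-b|k|^\alpha}$ and is integrable, and Gaussian smoothing shows that its inverse transform is a
nonnegative density.

For $\alpha>1$ the limiting symbol is itself integrable. If the support generates $\mathbb Z$, then
$\mathrm{Re}(1-\hat W)\ge\kappa|\varphi|^\alpha$ on $[-\pi,\pi]$
(`exists_le_re_one_sub_stepCharFun`), which dominates the rescaled symbols; their $L^1$ convergence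
is uniform convergence of the propagators. The special cases follow from Taylor expansion of $\hat
W$ and, for the Laplace law, from uniqueness of Fourier inverses. -/

theorem hasSum_geometric_tail {p : ℝ} (hp : 0 < p) (hp1 : p < 1) (m : ℕ) :
    HasSum (fun t : ℕ => if m ≤ t then p * (1 - p) ^ t else 0) ((1 - p) ^ m) := by
  rw [← hasSum_nat_add_iff' m]
  have h0 : ∑ i ∈ Finset.range m, (if m ≤ i then p * (1 - p) ^ i else 0) = 0 :=
    Finset.sum_eq_zero fun i hi => if_neg (by simpa using hi)
  rw [h0, sub_zero]
  have h := (hasSum_geometric_of_lt_one (r := 1 - p) (by linarith) (by linarith)).mul_left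
    (p * (1 - p) ^ m)
  have h1 : p * (1 - p) ^ m * (1 - (1 - p))⁻¹ = (1 - p) ^ m := by
    rw [sub_sub_cancel]; field_simp
  rw [h1] at h
  refine h.congr_fun fun i => ?_
  rw [if_pos (by omega), pow_add]; ring

theorem stoppingLaw_tail {p : ℝ} (hp : 0 < p) (hp1 : p < 1) (m : ℕ) :
    stoppingLaw p {T | m + 1 ≤ T} = ENNReal.ofReal ((1 - p) ^ m) := by
  have hq : 0 ≤ 1 - p := by linarith
  rw [stoppingLaw, Measure.sum_apply _ (MeasurableSet.of_discrete),
    ← (hasSum_geometric_tail hp hp1 m).tsum_eq, ENNReal.ofReal_tsum_of_nonneg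
      (fun t => by split_ifs <;> positivity) (hasSum_geometric_tail hp hp1 m).summable]
  refine tsum_congr fun t => ?_
  by_cases h : m ≤ t <;> simp [h, Set.indicator]

theorem isProbabilityMeasure_stoppingLaw {p : ℝ} (hp : 0 < p) (hp1 : p < 1) :
    IsProbabilityMeasure (stoppingLaw p) := by
  refine ⟨?_⟩
  have h0 : stoppingLaw p {0} = 0 := by
    simp [stoppingLaw, Measure.sum_apply _ (MeasurableSet.singleton (0 : ℕ))]
  have h1 := stoppingLaw_tail hp hp1 0
  simp only [zero_add, pow_zero, ENNReal.ofReal_one] at h1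
  have hU : (Set.univ : Set ℕ) = {0} ∪ {T | 1 ≤ T} := by
    ext t; simp; omega
  rw [hU, measure_union (by simp) MeasurableSet.of_discrete, h0, h1, zero_add]

theorem monotone_renewalTime (Δ : ℕ → ℕ) : Monotone (renewalTime Δ) := fun _ _ h =>
  Finset.sum_le_sum_of_subset (Finset.range_subset_range.2 h)

theorem le_renewalTime {Δ : ℕ → ℕ} (hΔ : ∀ j, 1 ≤ Δ j) (n : ℕ) : n ≤ renewalTime Δ n := by
  simpa [renewalTime] using Finset.card_nsmul_le_sum (Finset.range n) Δ 1 fun j _ => hΔ j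

/-- Waiting times of at least one give $J_n\ge n$, so the set defining $N(t)$ is bounded and its
supremum is attained; monotonicity of $J$ does the rest. -/
theorem le_renewalCount_iff {Δ : ℕ → ℕ} (hΔ : ∀ j, 1 ≤ Δ j) (n t : ℕ) :
    n ≤ renewalCount Δ t ↔ renewalTime Δ n ≤ t := by
  have hb : BddAbove {n : ℕ | renewalTime Δ n ≤ t} :=
    ⟨t, fun m hm => (le_renewalTime hΔ m).trans hm⟩
  refine ⟨fun h => ?_, fun h => le_csSup hb h⟩
  have hne : {n : ℕ | renewalTime Δ n ≤ t}.Nonempty := ⟨0, by simp [renewalTime]⟩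
  exact (monotone_renewalTime Δ h).trans (Nat.sSup_mem hne hb)

@[fun_prop]
theorem measurable_renewalTime (n : ℕ) : Measurable fun Δ : ℕ → ℕ => renewalTime Δ n := by
  unfold renewalTime; fun_prop

theorem measurable_renewalCount (t : ℕ) : Measurable fun Δ : ℕ → ℕ => renewalCount Δ t := by
  refine measurable_to_countable' fun n => ?_
  -- Waiting times may vanish here. If all renewal times stay below $t$, the set is unbounded and
  -- `sSup` takes the default value $0$, hence the second piece of the union, present only for
  -- $n=0$.
  have key : (fun Δ : ℕ → ℕ => renewalCount Δ t) ⁻¹' {n} =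
      {Δ | renewalTime Δ n ≤ t ∧ t < renewalTime Δ (n + 1)} ∪
        {Δ | n = 0 ∧ ∀ m, renewalTime Δ m ≤ t} := by
    ext Δ
    have hne : {n : ℕ | renewalTime Δ n ≤ t}.Nonempty := ⟨0, by simp [renewalTime]⟩
    simp only [Set.mem_preimage, Set.mem_singleton_iff, Set.mem_union, Set.mem_ofPred_eq]
    by_cases hb : BddAbove {n : ℕ | renewalTime Δ n ≤ t}
    · have hmem : renewalTime Δ (renewalCount Δ t) ≤ t := Nat.sSup_mem hne hb
      have hnot : ¬ ∀ m, renewalTime Δ m ≤ t := fun h => by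
        obtain ⟨b, hb⟩ := hb
        have h2 : b + 1 ≤ b := hb (h (b + 1))
        omega
      constructor
      · rintro rfl
        refine Or.inl ⟨hmem, ?_⟩
        by_contra! h
        have h2 : renewalCount Δ t + 1 ≤ renewalCount Δ t := le_csSup hb h
        omega
      · rintro (⟨h1, h2⟩ | h)
        · have h3 : n ≤ renewalCount Δ t := le_csSup hb h1
          by_contra! h4
          have h5 : n + 1 ≤ renewalCount Δ t := by omega
          exact absurd ((monotone_renewalTime Δ h5).trans hmem) (by omega)
        · exact absurd h.2 hnot
    · have h0 : renewalCount Δ t = 0 := Nat.sSup_of_not_bddAbove hb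
      have hall : ∀ m, renewalTime Δ m ≤ t := fun m => by
        by_contra! h
        refine hb ⟨m, fun k hk => ?_⟩
        by_contra! h2
        exact absurd ((monotone_renewalTime Δ h2.le).trans hk) (by omega)
      rw [h0]
      constructor
      · rintro rfl; exact Or.inr ⟨rfl, hall⟩
      · rintro (⟨_, h2⟩ | h)
        · exact absurd (hall (n + 1)) (by omega)
        · exact h.1.symm
  rw [key]
  refine MeasurableSet.union ?_ ?_
  · exact (measurableSet_le (measurable_renewalTime n) measurable_const).inter
      (measurableSet_lt measurable_const (measurable_renewalTime (n + 1)))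
  · by_cases hn : n = 0
    · simp only [hn, true_and, Set.ofPred_forall]
      exact MeasurableSet.iInter fun m => measurableSet_le (measurable_renewalTime m)
        measurable_const
    · simp [hn]

@[fun_prop]
theorem measurable_finalCount :
    Measurable fun ω : (ℕ → ℕ) × ℕ => renewalCount ω.1 ω.2 :=
  measurable_from_prod_countable_left fun t => measurable_renewalCount t

/-- Product moments of IID coordinates. -/
theorem integral_infinitePi_prod_range {X 𝕜 : Type*} [MeasurableSpace X] [RCLike 𝕜]
    (μ : Measure X) [IsProbabilityMeasure μ] {f : X → 𝕜} (hf : Measurable f) (n : ℕ) :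
    ∫ ω, ∏ j ∈ Finset.range n, f (ω j) ∂(Measure.infinitePi fun _ : ℕ => μ)
      = (∫ x, f x ∂μ) ^ n := by
  have hind : iIndepFun (fun (i : Fin n) (ω : ℕ → X) => f (ω i))
      (Measure.infinitePi fun _ : ℕ => μ) :=
    (iIndepFun_infinitePi (X := fun _ x => f x) (P := fun _ : ℕ => μ)
      (fun _ => hf)).precomp Fin.val_injective
  simp_rw [Finset.prod_range]
  rw [hind.integral_fun_prod_eq_prod_integral fun i => by
    have : Measurable fun ω : ℕ → X => f (ω i) := by fun_prop
    exact this.aestronglyMeasurable]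
  have h1 : ∀ i : Fin n, ∫ ω : ℕ → X, f (ω i) ∂(Measure.infinitePi fun _ : ℕ => μ)
      = ∫ x, f x ∂μ := fun i => by
    have hp := measurePreserving_eval_infinitePi (fun _ : ℕ => μ) (i : ℕ)
    rw [← hp.map_eq, integral_map hp.measurable.aemeasurable
      (by rw [hp.map_eq]; exact hf.aestronglyMeasurable), hp.map_eq]
  simp [h1]

/-! ### Generating function of the waiting times -/

theorem integrable_pow_of_pmf (ψ : PMF ℕ) {u : ℝ} (h0 : 0 ≤ u) (h1 : u ≤ 1) :
    Integrable (fun t : ℕ => u ^ t) ψ.toMeasure :=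
  Integrable.of_bound (Measurable.of_discrete.aestronglyMeasurable) 1
    (ae_of_all _ fun t => by
      rw [Real.norm_eq_abs, abs_of_nonneg (pow_nonneg h0 t)]; exact pow_le_one₀ h0 h1)

theorem waitingGF_eq_integral (ψ : PMF ℕ) {u : ℝ} (h0 : 0 ≤ u) (h1 : u ≤ 1) :
    waitingGF ψ u = ∫ t, u ^ t ∂ψ.toMeasure := by
  rw [PMF.integral_eq_tsum _ _ (integrable_pow_of_pmf ψ h0 h1)]; rfl

theorem ae_one_le_of_pmf {ψ : PMF ℕ} (hψ : ψ 0 = 0) : ∀ᵐ t ∂ψ.toMeasure, 1 ≤ t := by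
  have : ψ.toMeasure {0} = 0 := by
    rw [PMF.toMeasure_apply_singleton _ _ (MeasurableSet.singleton 0), hψ]
  rw [ae_iff]
  convert this using 2
  ext t; simp

theorem ae_one_le_waiting {ψ : PMF ℕ} (hψ : ψ 0 = 0) :
    ∀ᵐ Δ ∂(Measure.infinitePi fun _ : ℕ => ψ.toMeasure), ∀ j, 1 ≤ Δ j := by
  rw [ae_all_iff]
  intro j
  exact (measurePreserving_eval_infinitePi (fun _ : ℕ => ψ.toMeasure) j).quasiMeasurePreserving.ae
    (ae_one_le_of_pmf hψ)

theorem waitingGF_le {ψ : PMF ℕ} (hψ : ψ 0 = 0) {u : ℝ} (h0 : 0 ≤ u) (h1 : u ≤ 1) :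
    waitingGF ψ u ≤ u := by
  rw [waitingGF_eq_integral ψ h0 h1]
  calc ∫ t, u ^ t ∂ψ.toMeasure ≤ ∫ _, u ∂ψ.toMeasure := by
        refine integral_mono_ae (integrable_pow_of_pmf ψ h0 h1) (integrable_const _) ?_
        filter_upwards [ae_one_le_of_pmf hψ] with t ht
        simpa using pow_le_pow_of_le_one h0 h1 ht
    _ = u := by simp

theorem waitingGF_nonneg (ψ : PMF ℕ) {u : ℝ} (h0 : 0 ≤ u) : 0 ≤ waitingGF ψ u :=
  tsum_nonneg fun t => by positivity

theorem tendsto_waitingGF (ψ : PMF ℕ) :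
    Tendsto (fun p : ℝ => waitingGF ψ (1 - p)) (𝓝[>] 0) (𝓝 1) := by
  have h : Tendsto (fun p : ℝ => ∫ t, (1 - p) ^ t ∂ψ.toMeasure) (𝓝[>] 0)
      (𝓝 (∫ _, 1 ∂ψ.toMeasure)) := by
    refine tendsto_integral_filter_of_dominated_convergence (fun _ => 1)
      (Eventually.of_forall fun p => Measurable.of_discrete.aestronglyMeasurable) ?_
      (integrable_const _) (ae_of_all _ fun t => ?_)
    · filter_upwards [Ioo_mem_nhdsGT (zero_lt_one' ℝ)] with p hp
      refine ae_of_all _ fun t => ?_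
      have h0 : 0 ≤ 1 - p := by linarith [hp.2]
      rw [Real.norm_eq_abs, abs_of_nonneg (pow_nonneg h0 t)]
      exact pow_le_one₀ h0 (by linarith [hp.1])
    · have : Continuous fun p : ℝ => (1 - p) ^ t := by fun_prop
      simpa using (this.tendsto 0).mono_left nhdsWithin_le_nhds
  rw [integral_const, probReal_univ, one_smul] at h
  refine h.congr' ?_
  filter_upwards [Ioo_mem_nhdsGT (zero_lt_one' ℝ)] with p hp
  rw [waitingGF_eq_integral ψ (by linarith [hp.2]) (by linarith [hp.1])]

theorem isProbabilityMeasure_timeMeasure (ψ : PMF ℕ) {p : ℝ} (hp : 0 < p) (hp1 : p < 1) :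
    IsProbabilityMeasure (timeMeasure ψ p) := by
  have := isProbabilityMeasure_stoppingLaw hp hp1
  unfold timeMeasure; infer_instance

/-- Given the waiting times, $n<N(T)$ is the event $T\ge J_{n+1}$, of probability $q^{J_{n+1}-1}$.
The expectation factorizes over the independent waiting times. -/
theorem timeMeasure_lt_finalCount {ψ : PMF ℕ} (hψ : ψ 0 = 0) {p : ℝ} (hp : 0 < p) (hp1 : p < 1)
    (n : ℕ) : (timeMeasure ψ p).real {ω | n < renewalCount ω.1 ω.2} =
      waitingGF ψ (1 - p) ^ (n + 1) / (1 - p) := by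
  have hq : 0 < 1 - p := by linarith
  have := isProbabilityMeasure_stoppingLaw hp hp1
  have hms : MeasurableSet {ω : (ℕ → ℕ) × ℕ | n < renewalCount ω.1 ω.2} :=
    measurableSet_lt measurable_const measurable_finalCount
  have hint : Integrable (fun Δ : ℕ → ℕ => (1 - p) ^ renewalTime Δ (n + 1) / (1 - p))
      (Measure.infinitePi fun _ : ℕ => ψ.toMeasure) := by
    refine Integrable.div_const (Integrable.of_bound (Measurable.aestronglyMeasurable ?_) 1
      (ae_of_all _ fun Δ => ?_)) _
    · exact (Measurable.of_discrete (f := fun k : ℕ => (1 - p) ^ k)).comp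
        (measurable_renewalTime _)
    · rw [Real.norm_eq_abs, abs_of_nonneg (by positivity)]
      exact pow_le_one₀ hq.le (by linarith)
  have h1 : timeMeasure ψ p {ω | n < renewalCount ω.1 ω.2} =
      ∫⁻ Δ, ENNReal.ofReal ((1 - p) ^ renewalTime Δ (n + 1) / (1 - p))
        ∂(Measure.infinitePi fun _ : ℕ => ψ.toMeasure) := by
    rw [timeMeasure, Measure.prod_apply hms]
    refine lintegral_congr_ae ?_
    filter_upwards [ae_one_le_waiting hψ] with Δ hΔ
    -- The tail of $T$ at $k+1$ is $q^k$; this shift by one is the source of the division by $q$.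
    obtain ⟨k, hk⟩ : ∃ k, renewalTime Δ (n + 1) = k + 1 :=
      ⟨renewalTime Δ (n + 1) - 1, by have := le_renewalTime hΔ (n + 1); omega⟩
    have h2 : Prod.mk Δ ⁻¹' {ω : (ℕ → ℕ) × ℕ | n < renewalCount ω.1 ω.2} = {T | k + 1 ≤ T} := by
      ext T
      have := le_renewalCount_iff hΔ (n + 1) T
      rw [hk] at this
      exact this
    rw [h2, stoppingLaw_tail hp hp1, hk, pow_succ, mul_div_cancel_right₀ _ hq.ne']
  rw [Measure.real, h1, ← ofReal_integral_eq_lintegral_ofReal hint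
    (ae_of_all _ fun Δ => by positivity),
    ENNReal.toReal_ofReal (integral_nonneg fun Δ => by positivity), integral_div,
    waitingGF_eq_integral ψ hq.le (by linarith)]
  congr 1
  rw [← integral_infinitePi_prod_range ψ.toMeasure (f := fun t : ℕ => (1 - p) ^ t)
    Measurable.of_discrete]
  simp only [Finset.prod_pow_eq_pow_sum, renewalTime]

theorem waitingGF_lt_one {ψ : PMF ℕ} (hψ : ψ 0 = 0) {p : ℝ} (hp : 0 < p) (hp1 : p < 1) :
    waitingGF ψ (1 - p) < 1 :=
  (waitingGF_le hψ (by linarith) (by linarith)).trans_lt (by linarith)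

/-- Truncated geometric series up to the final number of arrivals. -/
theorem integral_geomSum_finalCount {ψ : PMF ℕ} (hψ : ψ 0 = 0) {p : ℝ} (hp : 0 < p)
    (hp1 : p < 1) {z : ℂ} (hz : ‖z‖ ≤ 1) :
    Integrable (fun ω : (ℕ → ℕ) × ℕ => ∑ j ∈ Finset.range (renewalCount ω.1 ω.2), z ^ j)
      (timeMeasure ψ p) ∧
    ∫ ω, ∑ j ∈ Finset.range (renewalCount ω.1 ω.2), z ^ j ∂(timeMeasure ψ p) =
      (waitingGF ψ (1 - p) : ℂ) / ((1 - p : ℝ) * (1 - z * waitingGF ψ (1 - p))) := by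
  have hq : 0 < 1 - p := by linarith
  have := isProbabilityMeasure_timeMeasure ψ hp hp1
  set g := waitingGF ψ (1 - p) with hg
  have hg0 : 0 ≤ g := waitingGF_nonneg ψ hq.le
  have hg1 : g < 1 := waitingGF_lt_one hψ hp hp1
  -- The truncated sum is $\sum_n z^n1_{n<N(T)}$. Expectation and sum are exchanged because the
  -- norms sum to at most $\frac gq\sum g^n<\infty$.
  let F : ℕ → (ℕ → ℕ) × ℕ → ℂ := fun n => Set.indicator
    {ω : (ℕ → ℕ) × ℕ | n < renewalCount ω.1 ω.2} (fun _ => z ^ n)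
  have hms : ∀ n, MeasurableSet {ω : (ℕ → ℕ) × ℕ | n < renewalCount ω.1 ω.2} := fun n =>
    measurableSet_lt measurable_const measurable_finalCount
  have hFi : ∀ n, Integrable (F n) (timeMeasure ψ p) := fun n =>
    (integrable_const (z ^ n)).indicator (hms n)
  have hFn : ∀ n, ∫ ω, ‖F n ω‖ ∂(timeMeasure ψ p) = ‖z‖ ^ n * (g ^ (n + 1) / (1 - p)) := by
    intro n
    have : ∀ ω, ‖F n ω‖ = Set.indicator {ω : (ℕ → ℕ) × ℕ | n < renewalCount ω.1 ω.2}
        (fun _ => ‖z‖ ^ n) ω := fun ω => by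
      rw [norm_indicator_eq_indicator_norm]; simp
    simp_rw [this]
    rw [integral_indicator_const _ (hms n), timeMeasure_lt_finalCount hψ hp hp1, smul_eq_mul,
      mul_comm]
  have hFI : ∀ n, ∫ ω, F n ω ∂(timeMeasure ψ p) = z ^ n * (g ^ (n + 1) / (1 - p) : ℝ) := by
    intro n
    simp only [F]
    rw [integral_indicator_const _ (hms n), timeMeasure_lt_finalCount hψ hp hp1,
      Complex.real_smul, mul_comm]
  have hsum : Summable fun n => ∫ ω, ‖F n ω‖ ∂(timeMeasure ψ p) := by
    simp_rw [hFn]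
    refine Summable.of_nonneg_of_le (fun n => by positivity) (fun n => ?_)
      ((summable_geometric_of_lt_one hg0 hg1).mul_right (g / (1 - p)))
    rw [pow_succ, mul_div_assoc]
    exact mul_le_of_le_one_left (by positivity) (pow_le_one₀ (norm_nonneg z) hz)
  have hpt : ∀ ω : (ℕ → ℕ) × ℕ, ∑' n, F n ω =
      ∑ j ∈ Finset.range (renewalCount ω.1 ω.2), z ^ j := by
    intro ω
    rw [tsum_eq_sum (s := Finset.range (renewalCount ω.1 ω.2))]
    · refine Finset.sum_congr rfl fun n hn => ?_
      exact Set.indicator_of_mem (s := {ω : (ℕ → ℕ) × ℕ | n < renewalCount ω.1 ω.2})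
        (by simpa using hn) _
    · intro n hn
      exact Set.indicator_of_notMem (s := {ω : (ℕ → ℕ) × ℕ | n < renewalCount ω.1 ω.2})
        (by simpa using hn) _
  have hH := hasSum_integral_of_summable_integral_norm hFi hsum
  simp_rw [hpt, hFI] at hH
  have hzg : ‖z * g‖ < 1 := by
    rw [norm_mul, Complex.norm_real, Real.norm_eq_abs, abs_of_nonneg hg0]
    exact (mul_le_of_le_one_left hg0 hz).trans_lt hg1
  have hne : (1 : ℂ) - z * g ≠ 0 := fun h => by
    rw [← sub_eq_zero.1 h] at hzg; simp at hzg
  refine ⟨?_, ?_⟩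
  · refine Integrable.congr (f := fun ω => ∑' n, F n ω) ?_ (ae_of_all _ hpt)
    refine ⟨?_, ?_⟩
    · have : Measurable fun ω : (ℕ → ℕ) × ℕ => ∑ j ∈ Finset.range (renewalCount ω.1 ω.2), z ^ j :=
        (Measurable.of_discrete (f := fun n : ℕ => ∑ j ∈ Finset.range n, z ^ j)).comp
          measurable_finalCount
      exact this.aestronglyMeasurable.congr (ae_of_all _ fun ω => (hpt ω).symm)
    · refine (hasFiniteIntegral_iff_enorm).2 ?_
      calc ∫⁻ ω, ‖∑' n, F n ω‖ₑ ∂(timeMeasure ψ p)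
          ≤ ∫⁻ ω, ∑' n, ‖F n ω‖ₑ ∂(timeMeasure ψ p) :=
            lintegral_mono fun ω => enorm_tsum_le_tsum_enorm
        _ = ∑' n, ∫⁻ ω, ‖F n ω‖ₑ ∂(timeMeasure ψ p) :=
            lintegral_tsum fun n => (hFi n).1.enorm
        _ = ∑' n, ENNReal.ofReal (∫ ω, ‖F n ω‖ ∂(timeMeasure ψ p)) := by
            refine tsum_congr fun n => ?_
            rw [ofReal_integral_norm_eq_lintegral_enorm (hFi n)]
        _ < ⊤ := hsum.tsum_ofReal_lt_top
  · refine hH.unique ?_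
    have h := (hasSum_geometric_of_norm_lt_one hzg).mul_left ((g : ℂ) / (1 - p : ℝ))
    have he : ((g : ℂ) / (1 - p : ℝ)) * (1 - z * g)⁻¹ = g / ((1 - p : ℝ) * (1 - z * g)) := by
      rw [div_mul_eq_div_div]; rfl
    rw [he] at h
    refine h.congr_fun fun n => ?_
    push_cast
    rw [mul_pow, pow_succ]; ring

theorem expectedFinalCount_eq {ψ : PMF ℕ} (hψ : ψ 0 = 0) {p : ℝ} (hp : 0 < p) (hp1 : p < 1) :
    expectedFinalCount ψ p = waitingGF ψ (1 - p) / ((1 - p) * (1 - waitingGF ψ (1 - p))) := by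
  have h := (integral_geomSum_finalCount hψ hp hp1 (z := 1) (by simp)).2
  have h2 : ((expectedFinalCount ψ p : ℝ) : ℂ) =
      ∫ ω, ∑ j ∈ Finset.range (renewalCount ω.1 ω.2), (1 : ℂ) ^ j ∂(timeMeasure ψ p) := by
    rw [expectedFinalCount, ← integral_complex_ofReal]
    simp
  rw [h] at h2
  rw [one_mul] at h2
  exact_mod_cast h2

theorem one_sub_mul_waitingGF_ne_zero {ψ : PMF ℕ} (hψ : ψ 0 = 0) {p : ℝ} (hp : 0 < p)
    (hp1 : p < 1) {z : ℂ} (hz : ‖z‖ ≤ 1) : (1 : ℂ) - z * waitingGF ψ (1 - p) ≠ 0 := fun h => by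
  have hg0 : 0 ≤ waitingGF ψ (1 - p) := waitingGF_nonneg ψ (by linarith)
  have hg1 : waitingGF ψ (1 - p) < 1 := waitingGF_lt_one hψ hp hp1
  have h1 : ‖z * (waitingGF ψ (1 - p) : ℂ)‖ = 1 := by rw [← sub_eq_zero.1 h]; simp
  rw [norm_mul, Complex.norm_real, Real.norm_eq_abs, abs_of_nonneg hg0] at h1
  nlinarith [norm_nonneg z]

/-- The generating function of the final number of arrivals. -/
theorem integral_pow_finalCount {ψ : PMF ℕ} (hψ : ψ 0 = 0) {p : ℝ} (hp : 0 < p)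
    (hp1 : p < 1) {z : ℂ} (hz : ‖z‖ ≤ 1) :
    ∫ ω : (ℕ → ℕ) × ℕ, z ^ renewalCount ω.1 ω.2 ∂(timeMeasure ψ p) =
      1 / (1 - p : ℝ) * ((1 - waitingGF ψ (1 - p) : ℝ) / (1 - z * waitingGF ψ (1 - p)) - p) := by
  obtain ⟨hi, hI⟩ := integral_geomSum_finalCount hψ hp hp1 hz
  have := isProbabilityMeasure_timeMeasure ψ hp hp1
  -- Telescoping passes from tail probabilities to the generating function without dividing by
  -- $z-1$, so that $z=1$ is included.
  have hpt : ∀ ω : (ℕ → ℕ) × ℕ, z ^ renewalCount ω.1 ω.2 =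
      1 + (z - 1) * ∑ j ∈ Finset.range (renewalCount ω.1 ω.2), z ^ j := fun ω => by
    rw [mul_geom_sum]; ring
  simp_rw [hpt]
  rw [integral_add (integrable_const _) (hi.const_mul _), integral_const_mul, hI]
  have hq : ((1 - p : ℝ) : ℂ) ≠ 0 := by
    exact_mod_cast (by linarith : (1 - p : ℝ) ≠ 0)
  have hne := one_sub_mul_waitingGF_ne_zero hψ hp hp1 hz
  simp only [integral_const, probReal_univ, one_smul]
  field_simp
  push_cast
  ring

/-! ## The law of the final position -/

/-- The law of a step, as a measure on the real line. -/
noncomputable def stepLaw (W : PMF ℤ) : Measure ℝ := W.toMeasure.map fun x : ℤ => (x : ℝ)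

instance (W : PMF ℤ) : IsProbabilityMeasure (stepLaw W) :=
  Measure.isProbabilityMeasure_map Measurable.of_discrete.aemeasurable

theorem integrable_cexp_int (m : Measure ℤ) [IsFiniteMeasure m] (φ : ℝ) :
    Integrable (fun x : ℤ => Complex.exp (-(Complex.I * φ * x))) m :=
  Integrable.of_bound Measurable.of_discrete.aestronglyMeasurable 1 (ae_of_all _ fun x => by
    have : -(Complex.I * φ * x) = ((-(φ * x) : ℝ) : ℂ) * Complex.I := by push_cast; ring
    rw [this, Complex.norm_exp_ofReal_mul_I])

theorem stepCharFun_eq_integral (W : PMF ℤ) (φ : ℝ) :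
    stepCharFun W φ = ∫ x : ℤ, Complex.exp (-(Complex.I * φ * x)) ∂W.toMeasure := by
  rw [PMF.integral_eq_tsum _ _ (integrable_cexp_int _ φ)]
  simp [stepCharFun]

/-- The kernel here is $e^{-i\varphi x}$ whereas `charFun` uses $e^{itx}$; all comparisons of the
two are therefore made at $-\varphi$. -/
theorem charFun_map_intCast (m : Measure ℤ) (r φ : ℝ) :
    charFun (m.map fun x : ℤ => (x : ℝ) / r) (-φ) =
      ∫ x : ℤ, Complex.exp (-(Complex.I * (φ / r : ℝ) * x)) ∂m := by
  rw [charFun_apply_real, integral_map Measurable.of_discrete.aemeasurable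
    (by fun_prop)]
  refine integral_congr_ae (ae_of_all _ fun x => ?_)
  simp only
  congr 1
  push_cast; ring

theorem stepCharFun_eq_charFun (W : PMF ℤ) (φ : ℝ) :
    stepCharFun W φ = charFun (stepLaw W) (-φ) := by
  have h := charFun_map_intCast W.toMeasure 1 φ
  simp only [div_one] at h
  rw [stepCharFun_eq_integral, stepLaw, h]

@[fun_prop]
theorem continuous_stepCharFun (W : PMF ℤ) : Continuous (stepCharFun W) := by
  rw [funext (stepCharFun_eq_charFun W)]
  fun_prop

theorem norm_stepCharFun_le (W : PMF ℤ) (φ : ℝ) : ‖stepCharFun W φ‖ ≤ 1 := by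
  rw [stepCharFun_eq_charFun]; exact norm_charFun_le_one _

theorem integral_cexp_stepSum (W : PMF ℤ) (φ : ℝ) (n : ℕ) :
    ∫ ξ : ℕ → ℤ, Complex.exp (-(Complex.I * φ * ((∑ j ∈ Finset.range n, ξ j : ℤ) : ℂ)))
      ∂(Measure.infinitePi fun _ : ℕ => W.toMeasure) = stepCharFun W φ ^ n := by
  rw [stepCharFun_eq_integral, ← integral_infinitePi_prod_range W.toMeasure
    (f := fun x : ℤ => Complex.exp (-(Complex.I * φ * x))) Measurable.of_discrete]
  refine integral_congr_ae (ae_of_all _ fun ξ => ?_)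
  simp only
  rw [← Complex.exp_sum]
  push_cast
  rw [Finset.mul_sum, Finset.sum_neg_distrib]

theorem measurable_stepSum :
    Measurable fun z : ℕ × (ℕ → ℤ) => ∑ j ∈ Finset.range z.1, z.2 j :=
  measurable_from_prod_countable_right fun n => by
    show Measurable fun ξ : ℕ → ℤ => ∑ j ∈ Finset.range n, ξ j
    fun_prop

/-- The final position `ξ_1 + ⋯ + ξ_{N(T)}` of the walker. -/
noncomputable def finalPosition (ω : ((ℕ → ℕ) × ℕ) × (ℕ → ℤ)) : ℤ :=
  ∑ j ∈ Finset.range (renewalCount ω.1.1 ω.1.2), ω.2 j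

@[fun_prop]
theorem measurable_finalPosition : Measurable finalPosition :=
  measurable_stepSum.comp ((measurable_finalCount.comp measurable_fst).prodMk measurable_snd)

theorem measurable_position (t : ℕ) :
    Measurable fun ω : ((ℕ → ℕ) × ℕ) × (ℕ → ℤ) => position ω.1.1 ω.1.2 ω.2 t := by
  have h : Measurable fun ω : (ℕ → ℕ) × ℕ => stoppedCount ω.1 ω.2 t := by
    refine Measurable.ite (measurableSet_lt measurable_const measurable_snd) ?_
      measurable_finalCount
    exact (measurable_renewalCount t).comp measurable_fst
  exact measurable_stepSum.comp ((h.comp measurable_fst).prodMk measurable_snd)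

theorem position_of_le {Δ : ℕ → ℕ} {T : ℕ} {ξ : ℕ → ℤ} {t : ℕ} (h : T ≤ t) :
    position Δ T ξ t = finalPosition ((Δ, T), ξ) := by
  simp [position, stoppedCount, finalPosition, not_lt.2 h]

theorem isProbabilityMeasure_walkMeasure (ψ : PMF ℕ) (W : PMF ℤ) {p : ℝ} (hp : 0 < p)
    (hp1 : p < 1) : IsProbabilityMeasure (walkMeasure ψ W p) := by
  have := isProbabilityMeasure_timeMeasure ψ hp hp1
  unfold walkMeasure; infer_instance

/-- The law of the final position. -/
noncomputable def finalLaw (ψ : PMF ℕ) (W : PMF ℤ) (p : ℝ) : Measure ℤ :=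
  (walkMeasure ψ W p).map finalPosition

theorem isProbabilityMeasure_finalLaw (ψ : PMF ℕ) (W : PMF ℤ) {p : ℝ} (hp : 0 < p)
    (hp1 : p < 1) : IsProbabilityMeasure (finalLaw ψ W p) := by
  have := isProbabilityMeasure_walkMeasure ψ W hp hp1
  exact Measure.isProbabilityMeasure_map measurable_finalPosition.aemeasurable

/-- Pathwise, $X_t$ is constant from the finite time $T$ on, so the indicators of the events
converge at every sample point. -/
theorem tendsto_propagator (ψ : PMF ℕ) (W : PMF ℤ) {p : ℝ} (hp : 0 < p) (hp1 : p < 1) (x : ℤ) :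
    Tendsto (fun t => propagator ψ W p t x) atTop (𝓝 ((finalLaw ψ W p).real {x})) := by
  have := isProbabilityMeasure_walkMeasure ψ W hp hp1
  have h1 : (finalLaw ψ W p).real {x} = (walkMeasure ψ W p).real {ω | finalPosition ω = x} := by
    rw [Measure.real, finalLaw, Measure.map_apply measurable_finalPosition (by simp)]
    rfl
  rw [h1]
  refine (ENNReal.tendsto_toReal (measure_ne_top _ _)).comp ?_
  refine tendsto_measure_of_ae_tendsto_indicator_of_isFiniteMeasure _
    (measurable_finalPosition (measurableSet_singleton x))
    (fun t => measurable_position t (measurableSet_singleton x)) (ae_of_all _ fun ω => ?_)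
  filter_upwards [eventually_ge_atTop ω.1.2] with t ht
  show position ω.1.1 ω.1.2 ω.2 t = x ↔ finalPosition ω = x
  rw [position_of_le ht]

theorem infinitePropagator_eq (ψ : PMF ℕ) (W : PMF ℤ) {p : ℝ} (hp : 0 < p) (hp1 : p < 1)
    (x : ℤ) : infinitePropagator ψ W p x = (finalLaw ψ W p).real {x} :=
  (tendsto_propagator ψ W hp hp1 x).limUnder_eq

/-- Conditionally on the times, the position is a sum of $N(T)$ independent steps, with transform
$\hat W(\varphi)^{N(T)}$. Averaging over the times evaluates the generating function of $N(T)$ at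
$z=\hat W(\varphi)$. -/
theorem integral_cexp_finalLaw {ψ : PMF ℕ} (hψ : ψ 0 = 0) (W : PMF ℤ) {p : ℝ} (hp : 0 < p)
    (hp1 : p < 1) (φ : ℝ) :
    ∫ x : ℤ, Complex.exp (-(Complex.I * φ * x)) ∂(finalLaw ψ W p) =
      1 / (1 - p : ℝ) * ((1 - waitingGF ψ (1 - p) : ℝ) /
        (1 - stepCharFun W φ * waitingGF ψ (1 - p)) - p) := by
  have h0 := isProbabilityMeasure_timeMeasure ψ hp hp1
  have h1 := isProbabilityMeasure_walkMeasure ψ W hp hp1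
  have h2 := isProbabilityMeasure_finalLaw ψ W hp hp1
  have hi : Integrable (fun ω => Complex.exp (-(Complex.I * φ * (finalPosition ω : ℂ))))
      (walkMeasure ψ W p) :=
    (integrable_map_measure Measurable.of_discrete.aestronglyMeasurable
      measurable_finalPosition.aemeasurable).1 (integrable_cexp_int (finalLaw ψ W p) φ)
  calc ∫ x : ℤ, Complex.exp (-(Complex.I * φ * x)) ∂(finalLaw ψ W p)
      = ∫ ω, Complex.exp (-(Complex.I * φ * (finalPosition ω : ℂ))) ∂(walkMeasure ψ W p) :=
        integral_map measurable_finalPosition.aemeasurable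
          Measurable.of_discrete.aestronglyMeasurable
    _ = ∫ ω, ∫ ξ, Complex.exp (-(Complex.I * φ * (finalPosition (ω, ξ) : ℂ)))
          ∂(Measure.infinitePi fun _ : ℕ => W.toMeasure) ∂(timeMeasure ψ p) :=
        integral_prod _ hi
    _ = ∫ ω, stepCharFun W φ ^ renewalCount ω.1 ω.2 ∂(timeMeasure ψ p) := by
        refine integral_congr_ae (ae_of_all _ fun ω => ?_)
        simp only [finalPosition]
        exact integral_cexp_stepSum W φ (renewalCount ω.1 ω.2)
    _ = _ := integral_pow_finalCount hψ hp hp1 (norm_stepCharFun_le W φ)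

/-! ## Fourier inversion on the integers -/

theorem integral_cexp_int (n : ℤ) :
    ∫ φ in (-Real.pi)..Real.pi, Complex.exp (Complex.I * φ * n) =
      if n = 0 then 2 * (Real.pi : ℂ) else 0 := by
  by_cases hn : n = 0
  · simp [hn]; ring
  · have hc : Complex.I * (n : ℂ) ≠ 0 := mul_ne_zero Complex.I_ne_zero (by exact_mod_cast hn)
    have h := integral_exp_mul_complex (a := -Real.pi) (b := Real.pi) hc
    have h1 : ∀ φ : ℝ, Complex.I * φ * n = Complex.I * n * φ := fun φ => by ring
    simp_rw [h1]
    rw [h, if_neg hn, div_eq_zero_iff]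
    left
    rw [sub_eq_zero, Complex.exp_eq_exp_iff_exists_int]
    exact ⟨n, by push_cast; ring⟩

/-- Fubini on a bounded integrand over a finite measure, followed by orthogonality of the
exponentials on $[-\pi,\pi]$. -/
theorem real_singleton_eq_integral (m : Measure ℤ) [IsFiniteMeasure m] (x : ℤ) :
    ((m.real {x} : ℝ) : ℂ) = 1 / (2 * Real.pi) * ∫ φ in (-Real.pi)..Real.pi,
      Complex.exp (Complex.I * φ * x) * ∫ y : ℤ, Complex.exp (-(Complex.I * φ * y)) ∂m := by
  have hpi : -Real.pi ≤ Real.pi := by linarith [Real.pi_pos]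
  have h1 : ∀ φ : ℝ, Complex.exp (Complex.I * φ * x) *
      ∫ y : ℤ, Complex.exp (-(Complex.I * φ * y)) ∂m =
        ∫ y : ℤ, Complex.exp (Complex.I * φ * (x - y : ℤ)) ∂m := fun φ => by
    rw [← integral_const_mul]
    refine integral_congr_ae (ae_of_all _ fun y => ?_)
    simp only
    rw [← Complex.exp_add]; congr 1; push_cast; ring
  simp_rw [h1]
  rw [intervalIntegral.integral_of_le hpi, integral_integral_swap]
  · simp_rw [← intervalIntegral.integral_of_le hpi, integral_cexp_int]
    have h2 : ∀ y : ℤ, (if x - y = 0 then 2 * (Real.pi : ℂ) else 0) =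
        Set.indicator {x} (fun _ => 2 * (Real.pi : ℂ)) y := fun y => by
      by_cases h : y = x
      · simp [h]
      · have : x - y ≠ 0 := fun h' => h (by omega)
        simp [h, this]
    simp_rw [h2]
    rw [integral_indicator_const _ (measurableSet_singleton x), Complex.real_smul]
    have : (Real.pi : ℂ) ≠ 0 := by exact_mod_cast Real.pi_ne_zero
    field_simp
  · refine Integrable.of_bound (Measurable.aestronglyMeasurable ?_) 1 (ae_of_all _ fun z => ?_)
    · refine measurable_from_prod_countable_left fun y => ?_
      simp only [Function.uncurry]
      fun_prop
    · have : Complex.I * z.1 * (x - z.2 : ℤ) = ((z.1 * (x - z.2 : ℤ) : ℝ) : ℂ) * Complex.I := by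
        push_cast; ring
      simp only [Function.uncurry]
      rw [this, Complex.norm_exp_ofReal_mul_I]

/-- The transform of the final law splits into the symbol of $P_q$ over $q$ and the constant $-p/q$;
the inverse transform of a constant is an atom at $0$. -/
theorem infinitePropagator_eq_auxPropagator {ψ : PMF ℕ} (hψ : ψ 0 = 0) (W : PMF ℤ) {p : ℝ}
    (hp : 0 < p) (hp1 : p < 1) (x : ℤ) :
    (infinitePropagator ψ W p x : ℂ) = 1 / ((1 - p : ℝ) : ℂ) * auxPropagator ψ W p x
      - (p : ℂ) / ((1 - p : ℝ) : ℂ) * (if x = 0 then 1 else 0) := by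
  have h2 := isProbabilityMeasure_finalLaw ψ W hp hp1
  have hpi : (Real.pi : ℂ) ≠ 0 := by exact_mod_cast Real.pi_ne_zero
  have hq : ((1 - p : ℝ) : ℂ) ≠ 0 := by exact_mod_cast (by linarith : (1 - p : ℝ) ≠ 0)
  rw [infinitePropagator_eq ψ W hp hp1, real_singleton_eq_integral]
  simp_rw [integral_cexp_finalLaw hψ W hp hp1]
  have h3 : ∀ φ : ℝ, Complex.exp (Complex.I * φ * x) * (1 / (1 - p : ℝ) *
      ((1 - waitingGF ψ (1 - p) : ℝ) / (1 - stepCharFun W φ * waitingGF ψ (1 - p)) - p)) =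
      (1 - waitingGF ψ (1 - p) : ℝ) / (1 - p : ℝ) * (Complex.exp (Complex.I * φ * x) /
        (1 - stepCharFun W φ * waitingGF ψ (1 - p))) -
        p / (1 - p : ℝ) * Complex.exp (Complex.I * φ * x) := fun φ => by ring
  simp_rw [h3]
  rw [intervalIntegral.integral_sub, intervalIntegral.integral_const_mul,
    intervalIntegral.integral_const_mul, integral_cexp_int, auxPropagator]
  · generalize (∫ φ in (-Real.pi)..Real.pi, Complex.exp (Complex.I * φ * x) /
      (1 - stepCharFun W φ * (waitingGF ψ (1 - p) : ℂ))) = J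
    split_ifs
    · field_simp
    · ring
  · refine Continuous.intervalIntegrable ?_ _ _
    refine continuous_const.mul (Continuous.div (by fun_prop) (by fun_prop) fun φ => ?_)
    exact one_sub_mul_waitingGF_ne_zero hψ hp hp1 (norm_stepCharFun_le W φ)
  · exact Continuous.intervalIntegrable (by fun_prop) _ _

theorem infinitePropagator_nonneg (ψ : PMF ℕ) (W : PMF ℤ) {p : ℝ} (hp : 0 < p) (hp1 : p < 1)
    (x : ℤ) : 0 ≤ infinitePropagator ψ W p x := by
  rw [infinitePropagator_eq ψ W hp hp1]; exact measureReal_nonneg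

theorem hasSum_infinitePropagator (ψ : PMF ℕ) (W : PMF ℤ) {p : ℝ} (hp : 0 < p) (hp1 : p < 1)
    {f : ℤ → ℝ} {C : ℝ} (hf : ∀ x, |f x| ≤ C) :
    HasSum (fun x => infinitePropagator ψ W p x * f x) (∫ x, f x ∂(finalLaw ψ W p)) := by
  have h2 := isProbabilityMeasure_finalLaw ψ W hp hp1
  have hi : Integrable f (finalLaw ψ W p) :=
    Integrable.of_bound Measurable.of_discrete.aestronglyMeasurable C (ae_of_all _ hf)
  have h := hasSum_integral_measure (μ := fun x : ℤ => finalLaw ψ W p {x} • Measure.dirac x)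
    (f := f) (by rwa [Measure.sum_smul_dirac])
  rw [Measure.sum_smul_dirac] at h
  refine h.congr_fun fun x => ?_
  rw [infinitePropagator_eq ψ W hp hp1, integral_smul_measure, integral_dirac, smul_eq_mul]
  rfl

/-! ## Lévy's continuity theorem -/

/-- A limit of characteristic functions that is continuous at `0` is a characteristic function. -/
theorem exists_measure_of_tendsto_charFun {μ : ℕ → ProbabilityMeasure ℝ} {f : ℝ → ℂ}
    (hf : ContinuousAt f 0)
    (h : ∀ t, Tendsto (fun n => charFun (μ n : Measure ℝ) t) atTop (𝓝 (f t))) :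
    ∃ ν : Measure ℝ, IsProbabilityMeasure ν ∧ ∀ t, charFun ν t = f t := by
  have htight : IsTightMeasureSet {((m : ProbabilityMeasure ℝ) : Measure ℝ) | m ∈ Set.range μ} := by
    have := isTightMeasureSet_of_tendsto_charFun (μ := fun n => (μ n : Measure ℝ)) hf h
    refine this.subset ?_
    rintro _ ⟨_, ⟨n, rfl⟩, rfl⟩
    exact ⟨n, rfl⟩
  have hc := isCompact_closure_of_isTightMeasureSet htight
  -- By Prokhorov the closure of the tight sequence is compact. A limit along an ultrafilter finer
  -- than `atTop` suffices, since the characteristic functions converge along the whole sequence.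
  let U : Ultrafilter ℕ := Ultrafilter.of atTop
  obtain ⟨ν, -, hν⟩ := hc.ultrafilter_le_nhds (U.map μ)
    (le_principal_iff.2 (mem_of_superset (Filter.Eventually.of_forall
      (fun n => subset_closure (Set.mem_range_self n)) : ∀ᶠ n in (U : Filter ℕ), μ n ∈ _)
      fun _ hx => hx))
  have hν' : Tendsto μ U (𝓝 ν) := hν
  refine ⟨ν, inferInstance, fun t => ?_⟩
  rw [ProbabilityMeasure.tendsto_iff_forall_integral_rclike_tendsto ℂ] at hν'
  have h1 := hν' (BoundedContinuousFunction.innerProbChar t)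
  simp_rw [← charFun_eq_integral_innerProbChar] at h1
  exact tendsto_nhds_unique h1 ((h t).mono_left (Ultrafilter.of_le atTop))

/-- Convergence of characteristic functions along a countably generated filter implies weak
convergence. -/
theorem tendsto_integral_of_tendsto_charFun {ι : Type*} {l : Filter ι} [l.IsCountablyGenerated]
    {μ : ι → Measure ℝ} (hμ : ∀ᶠ i in l, IsProbabilityMeasure (μ i)) {ν : Measure ℝ}
    [hν : IsProbabilityMeasure ν]
    (h : ∀ t, Tendsto (fun i => charFun (μ i) t) l (𝓝 (charFun ν t)))
    (f : BoundedContinuousFunction ℝ ℝ) :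
    Tendsto (fun i => ∫ x, f x ∂(μ i)) l (𝓝 (∫ x, f x ∂ν)) := by
  classical
  refine tendsto_of_seq_tendsto fun u hu => ?_
  -- Indices at which the measure is not a probability are filled with the limit law; only finitely
  -- many occur along a sequence tending to `l`.
  let m : ℕ → ProbabilityMeasure ℝ := fun n =>
    if hn : IsProbabilityMeasure (μ (u n)) then ⟨μ (u n), hn⟩ else ⟨ν, hν⟩
  have hm : ∀ᶠ n in atTop, (m n : Measure ℝ) = μ (u n) := by
    filter_upwards [hu.eventually hμ] with n hn
    have : m n = ⟨μ (u n), hn⟩ := dif_pos hn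
    rw [this]; rfl
  have h1 : Tendsto m atTop (𝓝 ⟨ν, hν⟩) := by
    refine ProbabilityMeasure.tendsto_of_tendsto_charFun fun t => ?_
    refine ((h t).comp hu).congr' ?_
    filter_upwards [hm] with n hn
    rw [hn]; rfl
  refine (ProbabilityMeasure.tendsto_iff_forall_integral_tendsto.1 h1 f).congr' ?_
  filter_upwards [hm] with n hn
  rw [hn]; rfl

/-! ## Fourier inversion of characteristic functions -/

/-- The inverse Fourier transform, in the normalization of `stableDensity`. -/
noncomputable def fourierDensity (φ : ℝ → ℂ) (y : ℝ) : ℂ :=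
  1 / (2 * (Real.pi : ℂ)) * ∫ k : ℝ, Complex.exp (Complex.I * k * y) * φ k

theorem norm_cexp_I_mul_mul (k y : ℝ) : ‖Complex.exp (Complex.I * k * y)‖ = 1 := by
  have : Complex.I * k * y = ((k * y : ℝ) : ℂ) * Complex.I := by push_cast; ring
  rw [this, Complex.norm_exp_ofReal_mul_I]

theorem integrable_cexp_mul {φ : ℝ → ℂ} (hφ : Integrable φ) (y : ℝ) :
    Integrable fun k : ℝ => Complex.exp (Complex.I * k * y) * φ k :=
  hφ.bdd_mul (c := 1) (Continuous.aestronglyMeasurable (by fun_prop))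
    (ae_of_all _ fun k => (norm_cexp_I_mul_mul k y).le)

theorem continuous_fourierDensity {φ : ℝ → ℂ} (hφ : Integrable φ) :
    Continuous (fourierDensity φ) := by
  refine continuous_const.mul (continuous_of_dominated (bound := fun k => ‖φ k‖) ?_ ?_ hφ.norm ?_)
  · exact fun y => (integrable_cexp_mul hφ y).aestronglyMeasurable
  · exact fun y => ae_of_all _ fun k => by rw [norm_mul, norm_cexp_I_mul_mul, one_mul]
  · exact ae_of_all _ fun k => by fun_prop

theorem norm_fourierDensity_le (φ : ℝ → ℂ) (y : ℝ) :
    ‖fourierDensity φ y‖ ≤ 1 / (2 * Real.pi) * ∫ k, ‖φ k‖ := by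
  have h1 : ‖(1 / (2 * (Real.pi : ℂ)))‖ = 1 / (2 * Real.pi) := by
    rw [norm_div, norm_mul, Complex.norm_real]; simp [abs_of_pos Real.pi_pos]
  rw [fourierDensity, norm_mul, h1]
  refine mul_le_mul_of_nonneg_left ((norm_integral_le_integral_norm _).trans_eq ?_)
    (by positivity)
  simp_rw [norm_mul, norm_cexp_I_mul_mul, one_mul]

open FourierTransform in
-- The substitution $k=2\pi\xi$ absorbs the prefactor $1/2\pi$ and passes to the normalization of
-- `𝓕⁻`.
theorem fourierDensity_eq_fourierInv (φ : ℝ → ℂ) (y : ℝ) :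
    fourierDensity φ y = 𝓕⁻ (fun ξ : ℝ => φ (2 * Real.pi * ξ)) y := by
  have h := Measure.integral_comp_mul_left (fun k : ℝ => Complex.exp (Complex.I * k * y) * φ k)
    (2 * Real.pi)
  rw [fourierDensity, Real.fourierInv_eq']
  have h2 : ∀ ξ : ℝ, Complex.exp (((2 * Real.pi * inner ℝ ξ y : ℝ) : ℂ) * Complex.I) •
      φ (2 * Real.pi * ξ) = Complex.exp (Complex.I * (2 * Real.pi * ξ : ℝ) * y) *
        φ (2 * Real.pi * ξ) := fun ξ => by
    rw [smul_eq_mul, real_inner_eq_re_inner]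
    congr 2
    simp; ring
  simp_rw [h2]
  rw [h, abs_of_pos (by positivity), Complex.real_smul]
  push_cast
  rw [one_div]

open FourierTransform in
theorem fourier_eq_of_integral_eq {f φ : ℝ → ℂ}
    (h : ∀ k : ℝ, ∫ y : ℝ, Complex.exp (-(Complex.I * k * y)) * f y = φ k) :
    𝓕 f = fun ξ : ℝ => φ (2 * Real.pi * ξ) := by
  ext ξ
  rw [Real.fourier_real_eq_integral_exp_smul, ← h]
  refine integral_congr_ae (ae_of_all _ fun y => ?_)
  simp only [smul_eq_mul]
  congr 2
  push_cast; ring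

/-- Fourier inversion for a function whose Fourier transform is integrable. -/
theorem fourierDensity_of_integral_eq {f φ : ℝ → ℂ} (hf : Continuous f) (hfi : Integrable f)
    (hφ : Integrable φ) (h : ∀ k : ℝ, ∫ y : ℝ, Complex.exp (-(Complex.I * k * y)) * f y = φ k) :
    fourierDensity φ = f := by
  have h1 := fourier_eq_of_integral_eq h
  have h2 := hf.fourierInv_fourier_eq hfi (by rw [h1]; exact hφ.comp_mul_left' (by positivity))
  rw [h1] at h2
  rw [← h2]
  exact funext fun y => fourierDensity_eq_fourierInv φ y

open FourierTransform in
-- The inversion theorem in the other direction: an integrable inverse transform gives back the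
-- symbol at every frequency. It is needed to identify the characteristic function of a density
-- built by inversion.
theorem integral_eq_of_fourierDensity {φ : ℝ → ℂ} (hφc : Continuous φ) (hφ : Integrable φ)
    (hf : Integrable (fourierDensity φ)) (k : ℝ) :
    ∫ y : ℝ, Complex.exp (-(Complex.I * k * y)) * fourierDensity φ y = φ k := by
  have hpi := Real.pi_ne_zero
  have h1 : fourierDensity φ = 𝓕⁻ fun ξ : ℝ => φ (2 * Real.pi * ξ) :=
    funext fun y => fourierDensity_eq_fourierInv φ y
  have h2 : Integrable (𝓕 fun ξ : ℝ => φ (2 * Real.pi * ξ)) := by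
    have h3 : (𝓕 fun ξ : ℝ => φ (2 * Real.pi * ξ)) = fun y => fourierDensity φ (-y) := by
      ext y
      rw [fourierDensity_eq_fourierInv, Real.fourierInv_eq_fourier_neg, neg_neg]
    rw [h3]
    exact hf.comp_neg
  have h4 := Continuous.fourier_fourierInv_eq
    (f := fun ξ : ℝ => φ (2 * Real.pi * ξ)) (by fun_prop) (hφ.comp_mul_left' (by positivity)) h2
  have h5 := fourier_eq_of_integral_eq (f := fourierDensity φ) (fun k => rfl)
  rw [← h1, h5] at h4
  have h6 := congrFun h4 (k / (2 * Real.pi))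
  rwa [mul_div_cancel₀ _ (by positivity : (2 * Real.pi) ≠ 0)] at h6

theorem fourierDensity_gaussian {v : NNReal} (hv : v ≠ 0) (z : ℝ) :
    fourierDensity (fun k => Complex.exp (-(v / 2 : ℝ) * (k : ℂ) ^ 2)) z =
      (gaussianPDFReal 0 v z : ℂ) := by
  have hv' : 0 < (v : ℝ) := by exact_mod_cast pos_iff_ne_zero.2 hv
  have h := fourierIntegral_gaussian (b := ((v / 2 : ℝ) : ℂ))
    (by rw [Complex.ofReal_re]; positivity) z
  have h1 : ∀ k : ℝ, Complex.I * k * z = Complex.I * z * k := fun k => by ring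
  simp only [fourierDensity]
  simp_rw [h1]
  rw [h]
  have h2 : ((Real.pi : ℂ) / ((v / 2 : ℝ) : ℂ)) ^ (1 / 2 : ℂ) =
      ((√(2 * Real.pi) / √v : ℝ) : ℂ) := by
    rw [← Real.sqrt_div (by positivity), Real.sqrt_eq_rpow,
      Complex.ofReal_cpow (by positivity)]
    push_cast
    congr 1
    have : (v : ℂ) ≠ 0 := by exact_mod_cast hv
    field_simp
  have h3 : Complex.exp (-(z : ℂ) ^ 2 / (4 * ((v / 2 : ℝ) : ℂ))) =
      ((Real.exp (-(z - 0) ^ 2 / (2 * v)) : ℝ) : ℂ) := by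
    push_cast
    congr 1
    have : (v : ℂ) ≠ 0 := by exact_mod_cast hv
    field_simp
    ring
  rw [h2, h3, gaussianPDFReal, Real.sqrt_mul (by positivity : 0 ≤ 2 * Real.pi) (v : ℝ)]
  have h4 : (1 : ℂ) / (2 * Real.pi) = ((1 / (√(2 * Real.pi) * √(2 * Real.pi)) : ℝ) : ℂ) := by
    rw [Real.mul_self_sqrt (by positivity)]; push_cast; rfl
  rw [h4, ← Complex.ofReal_mul, ← Complex.ofReal_mul]
  congr 1
  have h5 : √(2 * Real.pi) ≠ 0 := by positivity
  have h6 : √(v : ℝ) ≠ 0 := by positivity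
  field_simp

theorem integrable_cexp_gaussian {v : NNReal} (hv : v ≠ 0) :
    Integrable fun k : ℝ => Complex.exp (-(v / 2 : ℝ) * (k : ℂ) ^ 2) :=
  integrable_cexp_neg_mul_sq (b := ((v / 2 : ℝ) : ℂ)) (by
    have hv' : 0 < (v : ℝ) := by exact_mod_cast pos_iff_ne_zero.2 hv
    rw [Complex.ofReal_re]; positivity)

/-- A Gaussian factor on the Fourier side is convolution of $\nu$ with a Gaussian density.
Integrability of the Gaussian justifies Fubini whether or not the characteristic function of $\nu$
is integrable. -/
theorem fourierDensity_gaussian_mul {ν : Measure ℝ} [IsProbabilityMeasure ν] {v : NNReal}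
    (hv : v ≠ 0) (y : ℝ) :
    fourierDensity (fun k => Complex.exp (-(v / 2 : ℝ) * (k : ℂ) ^ 2) * charFun ν (-k)) y =
      ((∫ x, gaussianPDFReal 0 v (y - x) ∂ν : ℝ) : ℂ) := by
  have h1 : ∀ k : ℝ, Complex.exp (Complex.I * k * y) *
      (Complex.exp (-(v / 2 : ℝ) * (k : ℂ) ^ 2) * charFun ν (-k)) =
      ∫ x, Complex.exp (Complex.I * k * (y - x : ℝ)) *
        Complex.exp (-(v / 2 : ℝ) * (k : ℂ) ^ 2) ∂ν := fun k => by
    rw [charFun_apply_real, ← integral_const_mul, ← integral_const_mul]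
    refine integral_congr_ae (ae_of_all _ fun x => ?_)
    simp only
    rw [← Complex.exp_add, ← Complex.exp_add, ← Complex.exp_add]
    congr 1; push_cast; ring
  simp only [fourierDensity]
  simp_rw [h1]
  rw [integral_integral_swap, ← integral_complex_ofReal, ← integral_const_mul]
  · exact integral_congr_ae (ae_of_all _ fun x => fourierDensity_gaussian hv (y - x))
  · refine ((integrable_cexp_gaussian hv).comp_fst ν).bdd_mul (c := 1)
      (f := fun z : ℝ × ℝ => Complex.exp (Complex.I * z.1 * (y - z.2 : ℝ))) ?_ ?_
    · exact Continuous.aestronglyMeasurable (by fun_prop)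
    · exact ae_of_all _ fun z => (norm_cexp_I_mul_mul z.1 (y - z.2)).le

section Inversion

variable {ν : Measure ℝ} [IsProbabilityMeasure ν]

/-- As the variance $1/(n+1)$ tends to $0$ the Gaussian factor tends to $1$, with $|\hat\nu|$ as
dominating function. Hence the inverse transform of $\nu$ is a limit of real nonnegative numbers. -/
theorem tendsto_gaussian_conv (hφ : Integrable fun k => charFun ν (-k)) (y : ℝ) :
    Tendsto (fun n : ℕ => ((∫ x, gaussianPDFReal 0 (1 / (n + 1)) (y - x) ∂ν : ℝ) : ℂ)) atTop
      (𝓝 (fourierDensity (fun k => charFun ν (-k)) y)) := by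
  have hv : ∀ n : ℕ, (1 / (n + 1) : NNReal) ≠ 0 := fun n => by positivity
  simp_rw [← fun n => fourierDensity_gaussian_mul (ν := ν) (hv n) y]
  refine Tendsto.const_mul _ (tendsto_integral_of_dominated_convergence
    (fun k => ‖charFun ν (-k)‖) ?_ hφ.norm ?_ ?_)
  · intro n
    refine Continuous.aestronglyMeasurable ?_
    fun_prop
  · refine fun n => ae_of_all _ fun k => ?_
    rw [norm_mul, norm_cexp_I_mul_mul, one_mul, norm_mul]
    refine mul_le_of_le_one_left (norm_nonneg _) ?_
    have : -(((1 / (n + 1) : NNReal) : ℝ) / 2 : ℝ) * (k : ℂ) ^ 2 =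
        ((-((1 / (n + 1) : NNReal) / 2) * k ^ 2 : ℝ) : ℂ) := by push_cast; ring
    rw [this, Complex.norm_exp_ofReal, Real.exp_le_one_iff]
    have : 0 ≤ ((1 / (n + 1) : NNReal) : ℝ) := NNReal.coe_nonneg _
    nlinarith [sq_nonneg k]
  · refine ae_of_all _ fun k => Tendsto.const_mul _ ?_
    have h0 : Tendsto (fun n : ℕ => 1 / ((n : ℝ) + 1)) atTop (𝓝 0) :=
      tendsto_one_div_add_atTop_nhds_zero_nat
    have hc : Continuous fun s : ℝ =>
        Complex.exp (-(s / 2 : ℝ) * (k : ℂ) ^ 2) * charFun ν (-k) := by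
      fun_prop
    have := (hc.tendsto 0).comp h0
    simpa [Function.comp_def] using this

theorem fourierDensity_charFun_nonneg (hφ : Integrable fun k => charFun ν (-k)) (y : ℝ) :
    0 ≤ (fourierDensity (fun k => charFun ν (-k)) y).re :=
  ge_of_tendsto' ((Complex.continuous_re.tendsto _).comp (tendsto_gaussian_conv hφ y)) fun n => by
    simp only [Function.comp_apply, Complex.ofReal_re]
    exact integral_nonneg fun x => gaussianPDFReal_nonneg _ _ _

theorem ofReal_re_fourierDensity_charFun (hφ : Integrable fun k => charFun ν (-k)) (y : ℝ) :
    ((fourierDensity (fun k => charFun ν (-k)) y).re : ℂ) =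
      fourierDensity (fun k => charFun ν (-k)) y := by
  refine Complex.ext rfl ?_
  have := (Complex.continuous_im.tendsto _).comp (tendsto_gaussian_conv hφ y)
  simp only [Function.comp_def, Complex.ofReal_im] at this ⊢
  exact tendsto_nhds_unique tendsto_const_nhds this

/-- Fatou: each Gaussian convolution has mass one and they converge pointwise. The inequality is
enough for integrability, after which Fourier inversion identifies the measure. -/
theorem lintegral_fourierDensity_charFun_le (hφ : Integrable fun k => charFun ν (-k)) :
    ∫⁻ y, ENNReal.ofReal (fourierDensity (fun k => charFun ν (-k)) y).re ≤ 1 := by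
  have hm : Measurable fun z : ℝ × ℝ × NNReal => gaussianPDFReal 0 z.2.2 (z.1 - z.2.1) := by
    unfold gaussianPDFReal; fun_prop
  have hconv : ∀ n : ℕ, ∫⁻ y, ∫⁻ x, ENNReal.ofReal (gaussianPDFReal 0 (1 / (n + 1)) (y - x)) ∂ν
      = 1 := fun n => by
    have hv : (1 / (n + 1) : NNReal) ≠ 0 := by positivity
    rw [lintegral_lintegral_swap]
    · simp_rw [gaussianPDFReal_sub, zero_add, lintegral_gaussianPDFReal_eq_one _ hv]
      simp
    · exact (hm.comp (measurable_fst.prodMk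
        (measurable_snd.prodMk measurable_const))).ennreal_ofReal.aemeasurable
  have hof : ∀ (n : ℕ) (y : ℝ),
      ENNReal.ofReal (∫ x, gaussianPDFReal 0 (1 / (n + 1)) (y - x) ∂ν) =
        ∫⁻ x, ENNReal.ofReal (gaussianPDFReal 0 (1 / (n + 1)) (y - x)) ∂ν := fun n y => by
    refine ofReal_integral_eq_lintegral_ofReal ?_
      (ae_of_all _ fun x => gaussianPDFReal_nonneg _ _ _)
    refine Integrable.of_bound ?_ ((√(2 * Real.pi * (1 / (n + 1) : NNReal)))⁻¹)
      (ae_of_all _ fun x => ?_)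
    · exact (hm.comp (measurable_const.prodMk
        (measurable_id.prodMk measurable_const))).aestronglyMeasurable
    · rw [Real.norm_eq_abs, abs_of_nonneg (gaussianPDFReal_nonneg _ _ _), gaussianPDFReal]
      refine mul_le_of_le_one_right (by positivity) (Real.exp_le_one_iff.2 ?_)
      rw [neg_div, Left.neg_nonpos_iff]
      positivity
  have hlim : ∀ y, Tendsto (fun n : ℕ =>
      ∫⁻ x, ENNReal.ofReal (gaussianPDFReal 0 (1 / (n + 1)) (y - x)) ∂ν) atTop
      (𝓝 (ENNReal.ofReal (fourierDensity (fun k => charFun ν (-k)) y).re)) := fun y => by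
    simp_rw [← hof]
    refine ENNReal.tendsto_ofReal ?_
    simpa [Function.comp_def] using
      (Complex.continuous_re.tendsto _).comp (tendsto_gaussian_conv hφ y)
  calc ∫⁻ y, ENNReal.ofReal (fourierDensity (fun k => charFun ν (-k)) y).re
      = ∫⁻ y, liminf (fun n : ℕ =>
          ∫⁻ x, ENNReal.ofReal (gaussianPDFReal 0 (1 / (n + 1)) (y - x)) ∂ν) atTop :=
        lintegral_congr fun y => (hlim y).liminf_eq.symm
    _ ≤ liminf (fun n : ℕ => ∫⁻ y,
          ∫⁻ x, ENNReal.ofReal (gaussianPDFReal 0 (1 / (n + 1)) (y - x)) ∂ν) atTop := by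
        refine lintegral_liminf_le fun n => ?_
        exact Measurable.lintegral_prod_right' (f := fun z : ℝ × ℝ =>
          ENNReal.ofReal (gaussianPDFReal 0 (1 / (n + 1)) (z.1 - z.2)))
          (hm.comp (measurable_fst.prodMk (measurable_snd.prodMk measurable_const))).ennreal_ofReal
    _ = 1 := by simp_rw [hconv]; simp

theorem integrable_re_fourierDensity_charFun (hφ : Integrable fun k => charFun ν (-k)) :
    Integrable fun y => (fourierDensity (fun k => charFun ν (-k)) y).re := by
  refine ⟨(Complex.continuous_re.comp (continuous_fourierDensity hφ)).aestronglyMeasurable, ?_⟩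
  rw [hasFiniteIntegral_iff_ofReal (ae_of_all _ fun y => fourierDensity_charFun_nonneg hφ y)]
  exact (lintegral_fourierDensity_charFun_le hφ).trans_lt ENNReal.one_lt_top

theorem charFun_lawOfDensity {g : ℝ → ℝ} (hg : Measurable g) (h0 : ∀ y, 0 ≤ g y) (k : ℝ) :
    charFun (lawOfDensity g) (-k) = ∫ y : ℝ, Complex.exp (-(Complex.I * k * y)) * g y := by
  rw [charFun_apply_real, lawOfDensity, integral_withDensity_eq_integral_toReal_smul
    hg.ennreal_ofReal (ae_of_all _ fun y => ENNReal.ofReal_lt_top)]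
  refine integral_congr_ae (ae_of_all _ fun y => ?_)
  simp only
  rw [ENNReal.toReal_ofReal (h0 y), Complex.real_smul, mul_comm]
  congr 2
  push_cast; ring

/-- A probability measure with integrable characteristic function has the density given by
Fourier inversion. -/
theorem eq_lawOfDensity_fourierDensity (hφ : Integrable fun k => charFun ν (-k)) :
    ν = lawOfDensity fun y => (fourierDensity (fun k => charFun ν (-k)) y).re := by
  have hi := integrable_re_fourierDensity_charFun hφ
  have hfin : IsFiniteMeasure
      (lawOfDensity fun y => (fourierDensity (fun k => charFun ν (-k)) y).re) :=
    isFiniteMeasure_withDensity_ofReal hi.2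
  refine Measure.ext_of_charFun (funext fun t => ?_)
  have hm : Measurable fun y => (fourierDensity (fun k => charFun ν (-k)) y).re :=
    (Complex.continuous_re.comp (continuous_fourierDensity hφ)).measurable
  rw [← neg_neg t, charFun_lawOfDensity hm (fourierDensity_charFun_nonneg hφ)]
  simp_rw [ofReal_re_fourierDensity_charFun hφ]
  refine (integral_eq_of_fourierDensity (φ := fun k => charFun ν (-k)) (by fun_prop) hφ ?_
    (-t)).symm
  refine hi.ofReal.congr (ae_of_all _ fun y => ofReal_re_fourierDensity_charFun hφ y)

end Inversion

/-! ## The stable exponent -/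

theorem stableExponent_eq {α : ℝ} (hα : 0 < α) (θ k : ℝ) :
    stableExponent α θ k = ((|k| ^ α * Real.cos (Real.pi / 2 * α * θ) : ℝ) : ℂ) +
      Complex.I * ((|k| ^ α * Real.sign k * Real.sin (Real.pi / 2 * α * θ) : ℝ) : ℂ) := by
  rw [stableExponent, mul_comm Complex.I, Complex.exp_mul_I, ← Complex.ofReal_cos,
    ← Complex.ofReal_sin]
  rcases lt_trichotomy k 0 with hk | hk | hk
  · rw [Real.sign_of_neg hk]
    have : Real.pi / 2 * -1 * α * θ = -(Real.pi / 2 * α * θ) := by ring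
    rw [this, Real.cos_neg, Real.sin_neg]
    push_cast; ring
  · simp [hk, Real.zero_rpow hα.ne']
  · rw [Real.sign_of_pos hk]
    have : Real.pi / 2 * 1 * α * θ = Real.pi / 2 * α * θ := by ring
    rw [this]
    push_cast; ring

theorem re_stableExponent {α : ℝ} (hα : 0 < α) (θ k : ℝ) :
    (stableExponent α θ k).re = |k| ^ α * Real.cos (Real.pi / 2 * α * θ) := by
  rw [stableExponent_eq hα, Complex.add_re, Complex.ofReal_re, Complex.I_mul_re,
    Complex.ofReal_im, neg_zero, add_zero]

theorem stableExponent_mul {α : ℝ} (θ : ℝ) {r : ℝ} (hr : 0 < r) (k : ℝ) :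
    stableExponent α θ (r * k) = ((r ^ α : ℝ) : ℂ) * stableExponent α θ k := by
  have hs : Real.sign (r * k) = Real.sign k := by
    rcases lt_trichotomy k 0 with hk | hk | hk
    · rw [Real.sign_of_neg hk, Real.sign_of_neg (mul_neg_of_pos_of_neg hr hk)]
    · simp [hk]
    · rw [Real.sign_of_pos hk, Real.sign_of_pos (mul_pos hr hk)]
  rw [stableExponent, stableExponent, hs, abs_mul, abs_of_pos hr,
    Real.mul_rpow hr.le (abs_nonneg k)]
  push_cast; ring

theorem rpow_one_div_rpow {α : ℝ} (hα : 0 < α) {a : ℝ} (ha : 0 ≤ a) :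
    (a ^ (1 / α)) ^ α = a := by
  rw [← Real.rpow_mul ha, one_div_mul_cancel hα.ne', Real.rpow_one]

theorem stableExponent_rpow_mul {α : ℝ} (hα : 0 < α) (θ : ℝ) {a : ℝ} (ha : 0 < a) (k : ℝ) :
    stableExponent α θ (a ^ (1 / α) * k) = (a : ℂ) * stableExponent α θ k := by
  rw [stableExponent_mul θ (Real.rpow_pos_of_pos ha _), rpow_one_div_rpow hα ha.le]

theorem continuous_stableExponent {α : ℝ} (hα : 0 < α) (θ : ℝ) :
    Continuous (stableExponent α θ) := by
  -- Writing the odd power through positive and negative parts removes the discontinuous sign.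
  have h1 : ∀ k : ℝ, |k| ^ α * Real.sign k = (max k 0) ^ α - (max (-k) 0) ^ α := fun k => by
    rcases lt_trichotomy k 0 with hk | hk | hk
    · rw [Real.sign_of_neg hk, max_eq_right hk.le, max_eq_left (by linarith), abs_of_neg hk,
        Real.zero_rpow hα.ne']
      ring
    · simp [hk]
    · rw [Real.sign_of_pos hk, max_eq_left hk.le, max_eq_right (by linarith), abs_of_pos hk,
        Real.zero_rpow hα.ne']
      ring
  have h2 : ∀ f : ℝ → ℝ, Continuous f → Continuous fun k => f k ^ α := fun f hf =>
    hf.rpow_const fun _ => Or.inr hα.le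
  rw [funext (stableExponent_eq hα θ)]
  simp_rw [h1]
  have h3 := h2 _ continuous_abs
  have h4 := h2 (fun k => max k 0) (by fun_prop)
  have h5 := h2 (fun k => max (-k) 0) (by fun_prop)
  fun_prop

/-- The scaling limit of the expansion of the characteristic function of the steps. -/
theorem tendsto_mul_one_sub_stepCharFun {W : PMF ℤ} {α θ c : ℝ} (hα : 0 < α)
    (hW : StepExpansion W α θ c) {ι : Type*} {l : Filter ι} {u : ι → ℝ} (hu : Tendsto u l atTop)
    (k : ℝ) :
    Tendsto (fun i => (u i : ℂ) * (1 - stepCharFun W (k / u i ^ (1 / α)))) l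
      (𝓝 ((c : ℂ) * stableExponent α θ k)) := by
  have hφ : Tendsto (fun i => k / u i ^ (1 / α)) l (𝓝 0) :=
    tendsto_const_nhds.div_atTop ((tendsto_rpow_atTop (by positivity)).comp hu)
  have hpos : ∀ᶠ i in l, 0 < u i := hu.eventually_gt_atTop 0
  have hse : ∀ᶠ i in l, (u i : ℂ) * stableExponent α θ (k / u i ^ (1 / α)) =
      stableExponent α θ k := by
    filter_upwards [hpos] with i hi
    rw [← stableExponent_rpow_mul hα θ hi, mul_div_cancel₀]
    exact (Real.rpow_pos_of_pos hi _).ne'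
  have hsmall : Tendsto (fun i => (u i : ℂ) * (stepCharFun W (k / u i ^ (1 / α)) -
      (1 - (c : ℂ) * stableExponent α θ (k / u i ^ (1 / α))))) l (𝓝 0) := by
    have h1 := (IsBigO.of_bound (f := fun i => (u i : ℂ)) (g := u) (l := l) 1
      (Eventually.of_forall fun i => by simp)).mul_isLittleO (hW.comp_tendsto hφ)
    refine IsLittleO.tendsto_zero_of_tendsto (h1.trans_isBigO (k := fun _ => (1 : ℝ)) ?_)
      (tendsto_const_nhds (x := (1 : ℝ)))
    refine IsBigO.of_bound (|k| ^ α) ?_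
    filter_upwards [hpos] with i hi
    have h2 : |k / u i ^ (1 / α)| ^ α = |k| ^ α / u i := by
      rw [abs_div, abs_of_pos (Real.rpow_pos_of_pos hi _), Real.div_rpow (abs_nonneg k)
        (Real.rpow_nonneg hi.le _), rpow_one_div_rpow hα hi.le]
    have h3 : 0 ≤ |k| ^ α := Real.rpow_nonneg (abs_nonneg k) α
    simp only [Function.comp_apply]
    rw [h2, mul_div_cancel₀ _ hi.ne', norm_one, mul_one,
      Real.norm_eq_abs, abs_of_nonneg h3]
  have h4 : Tendsto (fun i => (c : ℂ) * stableExponent α θ k - (u i : ℂ) *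
      (stepCharFun W (k / u i ^ (1 / α)) -
        (1 - (c : ℂ) * stableExponent α θ (k / u i ^ (1 / α))))) l
      (𝓝 ((c : ℂ) * stableExponent α θ k - 0)) := tendsto_const_nhds.sub hsmall
  rw [sub_zero] at h4
  refine h4.congr' ?_
  filter_upwards [hse] with i hi
  rw [← hi]; ring

/-! ## The stable law -/

/-- The characteristic function of `ν` is `exp (-c (i^θ k)^α)`. -/
def HasStableCharFun (α θ c : ℝ) (ν : Measure ℝ) : Prop :=
  ∀ k : ℝ, charFun ν (-k) = Complex.exp (-((c : ℂ) * stableExponent α θ k))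

/-- A stable limit theorem for the steps: $S_n/n^{1/\alpha}$ has transform $\hat
W(kn^{-1/\alpha})^n=(1-\frac{c(i^\theta k)^\alpha+o(1)}n)^n$. The limit is continuous at $0$, hence
a characteristic function; no restriction on $\theta$ is put in, and those that hold are deduced
from $\nu$. -/
theorem exists_hasStableCharFun {W : PMF ℤ} {α θ c : ℝ} (hα : 0 < α)
    (hW : StepExpansion W α θ c) :
    ∃ ν : Measure ℝ, IsProbabilityMeasure ν ∧ HasStableCharFun α θ c ν := by
  let S : ℕ → Measure ℤ := fun n => (Measure.infinitePi fun _ : ℕ => W.toMeasure).map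
    fun ξ => ∑ j ∈ Finset.range n, ξ j
  have hm : ∀ n : ℕ, Measurable fun ξ : ℕ → ℤ => ∑ j ∈ Finset.range n, ξ j := fun n => by fun_prop
  have hS : ∀ n, IsProbabilityMeasure (S n) := fun n =>
    Measure.isProbabilityMeasure_map (hm n).aemeasurable
  let μ : ℕ → ProbabilityMeasure ℝ := fun n =>
    ⟨(S n).map fun x : ℤ => (x : ℝ) / (n : ℝ) ^ (1 / α),
      Measure.isProbabilityMeasure_map Measurable.of_discrete.aemeasurable⟩
  have hμ : ∀ (n : ℕ) (k : ℝ), charFun (μ n : Measure ℝ) (-k) =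
      stepCharFun W (k / (n : ℝ) ^ (1 / α)) ^ n := fun n k => by
    have h1 := charFun_map_intCast (S n) ((n : ℝ) ^ (1 / α)) k
    rw [← integral_cexp_stepSum]
    refine h1.trans ?_
    simp only [S]
    rw [integral_map (hm n).aemeasurable Measurable.of_discrete.aestronglyMeasurable]
  obtain ⟨ν, hν, h⟩ := exists_measure_of_tendsto_charFun (μ := μ)
    (f := fun t => Complex.exp (-((c : ℂ) * stableExponent α θ (-t)))) (by
      have := continuous_stableExponent hα θ
      exact Continuous.continuousAt (by fun_prop)) (fun t => by
      rw [← neg_neg t]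
      simp_rw [hμ]
      have h2 := (tendsto_mul_one_sub_stepCharFun hα hW tendsto_natCast_atTop_atTop (-t)).neg
      have h3 := Complex.tendsto_one_add_pow_exp_of_tendsto
        (g := fun n : ℕ => stepCharFun W (-t / (n : ℝ) ^ (1 / α)) - 1)
        (t := -((c : ℂ) * stableExponent α θ (-t))) (h2.congr fun n => by push_cast; ring)
      simpa using h3)
  exact ⟨ν, hν, fun k => by rw [h, neg_neg]⟩

section Stable

variable {α θ c : ℝ} {ν : Measure ℝ}

/-- By homogeneity, scaling by $a^{1/\alpha}$ multiplies the exponent by $a$, and convolution adds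
exponents. -/
theorem HasStableCharFun.isStable [IsProbabilityMeasure ν] (hα : 0 < α)
    (hν : HasStableCharFun α θ c ν) :
    IsStable α ν := by
  intro a b ha hb
  have hp : ∀ r : ℝ, IsProbabilityMeasure (ν.map fun y => r * y) := fun r =>
    Measure.isProbabilityMeasure_map (by fun_prop)
  have h1 : ∀ {r : ℝ}, 0 < r → ∀ k, charFun (ν.map fun y => r ^ (1 / α) * y) (-k) =
      Complex.exp (-((c : ℂ) * (r * stableExponent α θ k))) := fun {r} hr k => by
    rw [charFun_map_mul, mul_neg, hν, stableExponent_rpow_mul hα θ hr]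
  refine Measure.ext_of_charFun (funext fun t => ?_)
  rw [← neg_neg t, charFun_conv, h1 ha, h1 hb, h1 (add_pos ha hb), ← Complex.exp_add]
  congr 1; push_cast; ring

theorem HasStableCharFun.norm_eq (hα : 0 < α) (hν : HasStableCharFun α θ c ν) (k : ℝ) :
    ‖charFun ν (-k)‖ = Real.exp (-(c * Real.cos (Real.pi / 2 * α * θ)) * |k| ^ α) := by
  rw [hν, Complex.norm_exp, Complex.neg_re, Complex.re_ofReal_mul, re_stableExponent hα]
  congr 1; ring

theorem HasStableCharFun.cos_nonneg [IsProbabilityMeasure ν] (hα : 0 < α) (hc : 0 < c)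
    (hν : HasStableCharFun α θ c ν) :
    0 ≤ Real.cos (Real.pi / 2 * α * θ) := by
  have h := norm_charFun_le_one (μ := ν) (-1)
  rw [hν.norm_eq hα, Real.exp_le_one_iff] at h
  simp only [abs_one, Real.one_rpow, mul_one, Left.neg_nonpos_iff] at h
  exact nonneg_of_mul_nonneg_right h hc

/-- Equality in the triangle inequality for $\int e^{itx}\,d\nu$ forces $e^{itx}$ to be almost
surely constant; then so is its square. -/
theorem charFun_two_mul_of_norm_eq_one [IsProbabilityMeasure ν] {t : ℝ} (h : ‖charFun ν t‖ = 1) :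
    charFun ν (2 * t) = charFun ν t ^ 2 := by
  have hb : ∀ᵐ x : ℝ ∂ν, ‖Complex.exp (t * x * Complex.I)‖ ≤ 1 := ae_of_all _ fun x => by
    rw [← Complex.ofReal_mul, Complex.norm_exp_ofReal_mul_I]
  rcases ae_eq_const_or_norm_integral_lt_of_norm_le_const hb with h1 | h1
  · rw [average_eq_integral, ← charFun_apply_real] at h1
    rw [charFun_apply_real]
    calc ∫ x, Complex.exp ((2 * t : ℝ) * x * Complex.I) ∂ν
        = ∫ _, charFun ν t ^ 2 ∂ν := by
          refine integral_congr_ae ?_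
          filter_upwards [h1] with x hx
          simp only [Function.const_apply] at hx
          rw [← hx, ← Complex.exp_nat_mul]
          congr 1; push_cast; ring
      _ = charFun ν t ^ 2 := by simp
  · rw [← charFun_apply_real, h] at h1
    simp at h1

/-- A vanishing cosine makes the characteristic function unimodular everywhere, so doubling the
frequency squares it. As the exponent is multiplied by $2^\alpha$, this gives $e^{ibx^\alpha}=1$ for
all $x>0$ with $b$ proportional to $2^\alpha-2$. -/
theorem HasStableCharFun.eq_one_of_cos_eq_zero [IsProbabilityMeasure ν] (hα : 0 < α) (hc : 0 < c)
    (hν : HasStableCharFun α θ c ν) (hcos : Real.cos (Real.pi / 2 * α * θ) = 0) : α = 1 := by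
  by_contra hne
  have hsin : Real.sin (Real.pi / 2 * α * θ) ≠ 0 := fun h => by
    have := Real.sin_sq_add_cos_sq (Real.pi / 2 * α * θ)
    rw [h, hcos] at this; norm_num at this
  have h2 : (2 : ℝ) ^ α - 2 ≠ 0 := fun h => hne <| by
    have h3 : (2 : ℝ) ^ α = 2 ^ (1 : ℝ) := by rw [Real.rpow_one]; linarith
    exact (Real.rpow_right_inj (by norm_num) (by norm_num)).1 h3
  set b := c * (2 ^ α - 2) * Real.sin (Real.pi / 2 * α * θ) with hb
  have hb0 : b ≠ 0 := mul_ne_zero (mul_ne_zero hc.ne' h2) hsin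
  have key : ∀ x : ℝ, 0 < x → Complex.exp (((x ^ α * b : ℝ) : ℂ) * Complex.I) = 1 := by
    intro x hx
    have hn : ‖charFun ν (-x)‖ = 1 := by rw [hν.norm_eq hα, hcos]; simp
    have h4 := charFun_two_mul_of_norm_eq_one hn
    rw [mul_neg, hν, hν, stableExponent_mul θ two_pos, ← Complex.exp_nat_mul] at h4
    have h5 : stableExponent α θ x =
        Complex.I * ((x ^ α * Real.sin (Real.pi / 2 * α * θ) : ℝ) : ℂ) := by
      rw [stableExponent_eq hα, hcos, Real.sign_of_pos hx, abs_of_pos hx]; simp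
    have h6 : ((x ^ α * b : ℝ) : ℂ) * Complex.I =
        (2 : ℕ) * -((c : ℂ) * stableExponent α θ x) -
          -((c : ℂ) * (((2 : ℝ) ^ α : ℝ) * stableExponent α θ x)) := by
      rw [h5, hb]; push_cast; ring
    rw [h6, Complex.exp_sub, h4, div_self (Complex.exp_ne_zero _)]
  -- Choosing $x^\alpha=\pi/|b|$ makes the exponential $e^{\pm i\pi}=-1$, a contradiction.
  have hx : 0 < Real.pi / |b| := div_pos Real.pi_pos (abs_pos.2 hb0)
  have h7 := key ((Real.pi / |b|) ^ (1 / α)) (Real.rpow_pos_of_pos hx _)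
  rw [rpow_one_div_rpow hα hx.le] at h7
  rcases lt_or_gt_of_ne hb0 with hlt | hgt
  · have : Real.pi / |b| * b = -Real.pi := by rw [abs_of_neg hlt]; field_simp
    rw [this] at h7
    simp [Complex.exp_neg] at h7
    norm_num at h7
  · have : Real.pi / |b| * b = Real.pi := by rw [abs_of_pos hgt]; field_simp
    rw [this, Complex.exp_pi_mul_I] at h7
    norm_num at h7

theorem HasStableCharFun.cos_pos [IsProbabilityMeasure ν] (hα : 0 < α) (hc : 0 < c)
    (hν : HasStableCharFun α θ c ν)
    (h : ¬ (α = 1 ∧ Real.cos (Real.pi / 2 * θ) = 0)) :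
    0 < Real.cos (Real.pi / 2 * α * θ) := by
  refine lt_of_le_of_ne (hν.cos_nonneg hα hc) fun h0 => h ?_
  have h1 := hν.eq_one_of_cos_eq_zero hα hc h0.symm
  refine ⟨h1, ?_⟩
  rw [h0, h1, mul_one]

theorem HasStableCharFun.eq_dirac [IsProbabilityMeasure ν] (hν : HasStableCharFun 1 θ c ν)
    (h : Real.cos (Real.pi / 2 * θ) = 0) :
    ν = Measure.dirac (c * Real.sin (Real.pi / 2 * θ)) := by
  refine Measure.ext_of_charFun (funext fun t => ?_)
  rw [← neg_neg t, hν, charFun_dirac, stableExponent_eq one_pos, mul_one, h, Real.rpow_one]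
  have : |-t| * Real.sign (-t) = -t := by
    rcases lt_trichotomy (-t) 0 with hk | hk | hk
    · rw [Real.sign_of_neg hk, abs_of_neg hk]; ring
    · simp [hk]
    · rw [Real.sign_of_pos hk, abs_of_pos hk]; ring
  rw [this]
  congr 1
  simp
  ring

theorem integrable_comp_abs {f : ℝ → ℝ} (hf : IntegrableOn f (Set.Ioi 0)) :
    Integrable fun x => f |x| := by
  have h1 := (integrable_indicator_iff measurableSet_Ioi).2 hf
  refine (h1.add h1.comp_neg).congr ?_
  have h0 : ∀ᵐ x : ℝ, x ≠ 0 := by simp [ae_iff]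
  filter_upwards [h0] with x hx
  rcases lt_or_gt_of_ne hx with hk | hk
  · have h2 : x ∉ Set.Ioi (0 : ℝ) := by simpa using hk.le
    have h3 : -x ∈ Set.Ioi (0 : ℝ) := by simpa using hk
    rw [Pi.add_apply, Set.indicator_of_notMem h2, Set.indicator_of_mem h3, abs_of_neg hk, zero_add]
  · have h2 : x ∈ Set.Ioi (0 : ℝ) := hk
    have h3 : -x ∉ Set.Ioi (0 : ℝ) := by simpa using hk.le
    rw [Pi.add_apply, Set.indicator_of_mem h2, Set.indicator_of_notMem h3, abs_of_pos hk, add_zero]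

theorem integrable_exp_neg_mul_abs_rpow (hα : 0 < α) {b : ℝ} (hb : 0 < b) :
    Integrable fun k : ℝ => Real.exp (-b * |k| ^ α) :=
  integrable_comp_abs (f := fun k => Real.exp (-b * k ^ α)) <| by
    simpa using integrableOn_rpow_mul_exp_neg_mul_rpow (s := 0) (by norm_num) hα hb

theorem HasStableCharFun.integrable [IsProbabilityMeasure ν] (hα : 0 < α) (hc : 0 < c)
    (hν : HasStableCharFun α θ c ν)
    (hcos : 0 < Real.cos (Real.pi / 2 * α * θ)) : Integrable fun k => charFun ν (-k) := by
  refine Integrable.mono' (integrable_exp_neg_mul_abs_rpow hα (mul_pos hc hcos))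
    (Continuous.aestronglyMeasurable (by fun_prop)) (ae_of_all _ fun k => ?_)
  rw [hν.norm_eq hα]

theorem HasStableCharFun.stableDensity_eq (hν : HasStableCharFun α θ c ν) (y : ℝ) :
    stableDensity α θ c y = (fourierDensity (fun k => charFun ν (-k)) y).re := by
  rw [stableDensity, fourierDensity]
  simp_rw [hν _]

end Stable

/-! ## The exponential mixture of stable laws -/

theorem expMeasure_one_eq : expMeasure 1 =
    (volume.restrict (Set.Ioi 0)).withDensity fun τ : ℝ => ENNReal.ofReal (Real.exp (-τ)) := by
  rw [← withDensity_indicator measurableSet_Ioi]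
  refine withDensity_congr_ae ?_
  have h0 : ∀ᵐ x : ℝ, x ≠ 0 := by simp [ae_iff]
  filter_upwards [h0] with x hx
  have h := exponentialPDF_eq 1 x
  rw [exponentialPDF, exponentialPDFReal] at h
  rw [gammaPDF, h]
  rcases lt_or_gt_of_ne hx with hk | hk
  · rw [Set.indicator_of_notMem (by simpa using hk.le), if_neg (not_le.2 hk), ENNReal.ofReal_zero]
  · rw [Set.indicator_of_mem (by simpa using hk), if_pos hk.le, one_mul, one_mul]

instance : IsProbabilityMeasure (expMeasure 1) := isProbabilityMeasure_expMeasure one_pos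

theorem ae_pos_expMeasure : ∀ᵐ τ ∂(expMeasure 1), 0 < τ := by
  rw [expMeasure_one_eq]
  exact (withDensity_absolutelyContinuous _ _).ae_le (ae_restrict_mem measurableSet_Ioi)

theorem lintegral_expMeasure_one {f : ℝ → ENNReal} (hf : Measurable f) :
    ∫⁻ τ, f τ ∂(expMeasure 1) =
      ∫⁻ τ in Set.Ioi 0, ENNReal.ofReal (Real.exp (-τ)) * f τ := by
  rw [expMeasure_one_eq, lintegral_withDensity_eq_lintegral_mul _ (by fun_prop) hf]
  rfl

theorem integral_expMeasure_one (f : ℝ → ℂ) :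
    ∫ τ, f τ ∂(expMeasure 1) = ∫ τ in Set.Ioi 0, (Real.exp (-τ) : ℂ) * f τ := by
  rw [expMeasure_one_eq, integral_withDensity_eq_integral_toReal_smul (by fun_prop)
    (ae_of_all _ fun y => ENNReal.ofReal_lt_top)]
  refine integral_congr_ae (ae_of_all _ fun τ => ?_)
  simp only
  rw [ENNReal.toReal_ofReal (Real.exp_nonneg _), Complex.real_smul]

theorem measurable_rpow_mul (α : ℝ) : Measurable fun z : ℝ × ℝ => z.1 ^ (1 / α) * z.2 := by
  fun_prop

instance (α : ℝ) (ν : Measure ℝ) [IsProbabilityMeasure ν] : IsProbabilityMeasure (nessLaw α ν) :=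
  Measure.isProbabilityMeasure_map (measurable_rpow_mul α).aemeasurable

theorem nessLaw_apply (α : ℝ) (ν : Measure ℝ) [IsProbabilityMeasure ν] {s : Set ℝ}
    (hs : MeasurableSet s) : nessLaw α ν s = ∫⁻ τ in Set.Ioi 0, ENNReal.ofReal (Real.exp (-τ)) *
      ∫⁻ y, s.indicator 1 (τ ^ (1 / α) * y) ∂ν := by
  have hm : Measurable fun z : ℝ × ℝ => (s.indicator 1 (z.1 ^ (1 / α) * z.2) : ENNReal) :=
    (measurable_one.indicator hs).comp (measurable_rpow_mul α)
  rw [← lintegral_indicator_one hs, nessLaw,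
    lintegral_map (measurable_one.indicator hs) (measurable_rpow_mul α), lintegral_prod _
    hm.aemeasurable, lintegral_expMeasure_one hm.lintegral_prod_right']

theorem re_one_add_pos {α θ c : ℝ} (hα : 0 < α) (hc : 0 < c)
    (hcos : 0 ≤ Real.cos (Real.pi / 2 * α * θ)) (k : ℝ) :
    1 ≤ (1 + (c : ℂ) * stableExponent α θ k).re := by
  rw [Complex.add_re, Complex.re_ofReal_mul, re_stableExponent hα, Complex.one_re]
  have := Real.rpow_nonneg (abs_nonneg k) α
  have : 0 ≤ c * (|k| ^ α * Real.cos (Real.pi / 2 * α * θ)) := by positivity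
  linarith

theorem one_add_ne_zero {α θ c : ℝ} (hα : 0 < α) (hc : 0 < c)
    (hcos : 0 ≤ Real.cos (Real.pi / 2 * α * θ)) (k : ℝ) :
    1 + (c : ℂ) * stableExponent α θ k ≠ 0 := fun h => by
  have := re_one_add_pos hα hc hcos k
  rw [h] at this
  norm_num at this

theorem integral_cexp_neg_mul_Ioi {z : ℂ} (hz : 0 < z.re) :
    ∫ τ in Set.Ioi (0 : ℝ), Complex.exp (-(z * τ)) = 1 / z := by
  have h := integral_exp_mul_complex_Ioi (a := -z) (by simpa using hz) 0
  simp only [neg_mul, Complex.ofReal_zero, mul_zero, Complex.exp_zero,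
    neg_div_neg_eq] at h
  exact h

/-- Given $\tau$, homogeneity gives the transform $e^{-\tau c(i^\theta k)^\alpha}$. Averaging over
$\tau$ is a Laplace transform at a point of real part at least $1$. -/
theorem HasStableCharFun.charFun_nessLaw {α θ c : ℝ} {ν : Measure ℝ} [IsProbabilityMeasure ν]
    (hα : 0 < α) (hc : 0 < c) (hν : HasStableCharFun α θ c ν) (k : ℝ) :
    charFun (nessLaw α ν) (-k) = 1 / (1 + (c : ℂ) * stableExponent α θ k) := by
  have hcos := hν.cos_nonneg hα hc
  have hm := measurable_rpow_mul α
  rw [charFun_apply_real, nessLaw, integral_map hm.aemeasurable (by fun_prop), integral_prod]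
  · have h1 : ∀ τ : ℝ, 0 < τ →
        ∫ y : ℝ, Complex.exp (((-k : ℝ) : ℂ) * ((τ ^ (1 / α) * y : ℝ) : ℂ) * Complex.I) ∂ν =
          Complex.exp (-((c : ℂ) * (τ * stableExponent α θ k))) := fun τ hτ => by
      rw [← stableExponent_rpow_mul hα θ hτ, ← hν, charFun_apply_real]
      refine integral_congr_ae (ae_of_all _ fun y => ?_)
      simp only
      congr 1; push_cast; ring
    calc ∫ τ : ℝ, ∫ y : ℝ, Complex.exp (((-k : ℝ) : ℂ) * ((τ ^ (1 / α) * y : ℝ) : ℂ) * Complex.I) ∂ν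
          ∂(expMeasure 1)
        = ∫ τ : ℝ, Complex.exp (-((c : ℂ) * (τ * stableExponent α θ k))) ∂(expMeasure 1) := by
          refine integral_congr_ae ?_
          filter_upwards [ae_pos_expMeasure] with τ hτ
          exact h1 τ hτ
      _ = ∫ τ in Set.Ioi (0 : ℝ), Complex.exp (-((1 + (c : ℂ) * stableExponent α θ k) * τ)) := by
          rw [integral_expMeasure_one]
          refine integral_congr_ae (ae_of_all _ fun τ => ?_)
          simp only
          rw [Complex.ofReal_exp, ← Complex.exp_add]
          congr 1; push_cast; ring
      _ = _ := integral_cexp_neg_mul_Ioi (zero_lt_one.trans_le (re_one_add_pos hα hc hcos k))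
  · refine Integrable.of_bound (Measurable.aestronglyMeasurable (by fun_prop)) 1
      (ae_of_all _ fun z => ?_)
    rw [← Complex.ofReal_mul, Complex.norm_exp_ofReal_mul_I]

/-! ## Weak convergence of the rescaled propagators -/

/-- By the formula for $E\,N(T)$, $\lambda(1-g)\sim g/q\to1$; and $1-g$ tends to $0$ through
positive values, so $\lambda\to\infty$. -/
theorem tendsto_atTop_of_isScaling {ψ : PMF ℕ} (hψ : ψ 0 = 0) {s : ℝ → ℝ} (hs : IsScaling ψ s) :
    Tendsto (fun p => s p * (1 - waitingGF ψ (1 - p))) (𝓝[>] 0) (𝓝 1) ∧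
      Tendsto s (𝓝[>] 0) atTop := by
  have hg := tendsto_waitingGF ψ
  have hI : ∀ᶠ p : ℝ in 𝓝[>] 0, p ∈ Set.Ioo (0 : ℝ) 1 := Ioo_mem_nhdsGT (zero_lt_one' ℝ)
  have hp : Tendsto (fun p : ℝ => p) (𝓝[>] 0) (𝓝 0) := tendsto_id.mono_left nhdsWithin_le_nhds
  have hgt : Tendsto (fun p : ℝ => 1 - waitingGF ψ (1 - p)) (𝓝[>] 0) (𝓝[>] 0) := by
    refine tendsto_nhdsWithin_iff.2 ⟨by simpa using hg.const_sub 1, ?_⟩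
    filter_upwards [hI] with p hp
    have := waitingGF_lt_one hψ hp.1 hp.2
    show 0 < 1 - waitingGF ψ (1 - p)
    linarith
  have h1 : Tendsto (fun p => s p * (1 - waitingGF ψ (1 - p))) (𝓝[>] 0) (𝓝 1) := by
    have h2 : (fun p => s p * (1 - waitingGF ψ (1 - p))) ~[𝓝[>] 0]
        fun p => expectedFinalCount ψ p * (1 - waitingGF ψ (1 - p)) := IsEquivalent.mul hs .refl
    refine h2.symm.tendsto_nhds ?_
    have h3 : Tendsto (fun p : ℝ => waitingGF ψ (1 - p) / (1 - p)) (𝓝[>] 0) (𝓝 1) := by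
      have := hg.div (hp.const_sub 1) (by norm_num)
      rwa [sub_zero, div_one] at this
    refine h3.congr' ?_
    filter_upwards [hI] with p hp
    rw [expectedFinalCount_eq hψ hp.1 hp.2]
    have h4 : 1 - p ≠ 0 := by linarith [hp.2]
    have h5 : 1 - waitingGF ψ (1 - p) ≠ 0 := by linarith [waitingGF_lt_one hψ hp.1 hp.2]
    field_simp
  refine ⟨h1, ?_⟩
  refine (h1.pos_mul_atTop one_pos (tendsto_inv_nhdsGT_zero.comp hgt)).congr' ?_
  filter_upwards [hI] with p hp
  have h5 : 1 - waitingGF ψ (1 - p) ≠ 0 := by linarith [waitingGF_lt_one hψ hp.1 hp.2]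
  simp only [Function.comp_apply]
  field_simp

/-- Multiply numerator and denominator by $\lambda$ and split $\lambda(1-\hat
Wg)=\lambda(1-g)+g\,\lambda(1-\hat W)$. -/
theorem tendsto_geometric_stepCharFun {W : PMF ℤ} {α θ c : ℝ} (hα : 0 < α) (hc : 0 < c)
    (hW : StepExpansion W α θ c) (hcos : 0 ≤ Real.cos (Real.pi / 2 * α * θ))
    {ψ : PMF ℕ} (hψ : ψ 0 = 0) {s : ℝ → ℝ} (hs : IsScaling ψ s) (k : ℝ) :
    Tendsto (fun p => ((1 - waitingGF ψ (1 - p) : ℝ) : ℂ) /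
      (1 - stepCharFun W (k / s p ^ (1 / α)) * waitingGF ψ (1 - p))) (𝓝[>] 0)
      (𝓝 (1 / (1 + (c : ℂ) * stableExponent α θ k))) := by
  obtain ⟨h1, h2⟩ := tendsto_atTop_of_isScaling hψ hs
  have hg : Tendsto (fun p => (waitingGF ψ (1 - p) : ℂ)) (𝓝[>] 0) (𝓝 1) := by
    exact_mod_cast (Complex.continuous_ofReal.tendsto 1).comp (tendsto_waitingGF ψ)
  have h1' : Tendsto (fun p => ((s p * (1 - waitingGF ψ (1 - p)) : ℝ) : ℂ)) (𝓝[>] 0) (𝓝 1) := by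
    exact_mod_cast (Complex.continuous_ofReal.tendsto 1).comp h1
  have h3 := tendsto_mul_one_sub_stepCharFun hα hW h2 k
  have h4 := h1'.add (hg.mul h3)
  rw [one_mul] at h4
  refine (h1'.div h4 (one_add_ne_zero hα hc hcos k)).congr' ?_
  filter_upwards [h2.eventually_gt_atTop 0] with p hp
  have hsp : (s p : ℂ) ≠ 0 := by exact_mod_cast hp.ne'
  have h5 : ((s p * (1 - waitingGF ψ (1 - p)) : ℝ) : ℂ) + (waitingGF ψ (1 - p) : ℂ) *
      (s p * (1 - stepCharFun W (k / s p ^ (1 / α)))) =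
      s p * (1 - stepCharFun W (k / s p ^ (1 / α)) * waitingGF ψ (1 - p)) := by
    push_cast; ring
  simp only [Pi.div_apply]
  rw [h5, Complex.ofReal_mul, mul_div_mul_left _ _ hsp]

theorem HasStableCharFun.convergesToNESS {W : PMF ℤ} {α θ c : ℝ} (hα : 0 < α) (hc : 0 < c)
    (hW : StepExpansion W α θ c) {ν : Measure ℝ} [IsProbabilityMeasure ν]
    (hν : HasStableCharFun α θ c ν) : ConvergesToNESS W α (nessLaw α ν) := by
  intro ψ hψ s hs f
  have hcos := hν.cos_nonneg hα hc
  have hI : ∀ᶠ p : ℝ in 𝓝[>] 0, p ∈ Set.Ioo (0 : ℝ) 1 := Ioo_mem_nhdsGT (zero_lt_one' ℝ)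
  have hp : Tendsto (fun p : ℝ => p) (𝓝[>] 0) (𝓝 0) := tendsto_id.mono_left nhdsWithin_le_nhds
  let μ : ℝ → Measure ℝ := fun p => (finalLaw ψ W p).map fun x : ℤ => (x : ℝ) / s p ^ (1 / α)
  have hμ : ∀ᶠ p in 𝓝[>] 0, IsProbabilityMeasure (μ p) := by
    filter_upwards [hI] with p hp
    have := isProbabilityMeasure_finalLaw ψ W hp.1 hp.2
    exact Measure.isProbabilityMeasure_map Measurable.of_discrete.aemeasurable
  have hchar : ∀ t, Tendsto (fun p => charFun (μ p) t) (𝓝[>] 0)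
      (𝓝 (charFun (nessLaw α ν) t)) := fun t => by
    rw [← neg_neg t, hν.charFun_nessLaw hα hc]
    have hpc : Tendsto (fun p : ℝ => (p : ℂ)) (𝓝[>] 0) (𝓝 0) := by
      exact_mod_cast (Complex.continuous_ofReal.tendsto 0).comp hp
    have h1 := ((tendsto_const_nhds (x := (1 : ℂ))).div (hpc.const_sub 1) (by simp)).mul
      ((tendsto_geometric_stepCharFun hα hc hW hcos hψ hs (-t)).sub hpc)
    simp only [sub_zero, div_one, one_mul] at h1
    refine h1.congr' ?_
    filter_upwards [hI] with p hp
    have h2 := charFun_map_intCast (finalLaw ψ W p) (s p ^ (1 / α)) (-t)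
    rw [integral_cexp_finalLaw hψ W hp.1 hp.2] at h2
    rw [h2]
    push_cast; rfl
  have hbound : ∀ (p : ℝ) (x : ℤ), |f (x / s p ^ (1 / α))| ≤ ‖f‖ := fun p x =>
    f.norm_coe_le_norm _
  have hsum : ∀ p, 0 < p → p < 1 → HasSum
      (fun x : ℤ => infinitePropagator ψ W p x * f (x / s p ^ (1 / α))) (∫ y, f y ∂(μ p)) := by
    intro p hp hp1
    have h := hasSum_infinitePropagator ψ W hp hp1 (hbound p)
    have h2 : ∫ y, f y ∂(μ p) = ∫ x : ℤ, f (x / s p ^ (1 / α)) ∂(finalLaw ψ W p) :=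
      integral_map Measurable.of_discrete.aemeasurable (by fun_prop)
    rwa [h2]
  have hlim := tendsto_integral_of_tendsto_charFun hμ hchar f
  refine ⟨hlim.congr' ?_, ?_⟩
  · filter_upwards [hI] with p hp
    exact (hsum p hp.1 hp.2).tsum_eq.symm
  -- Solving the relation for $P_q$ gives the mixture $P_q=qP+p\,\delta_0$, whose second part
  -- disappears in the limit.
  · have h3 : Tendsto (fun p : ℝ => (((1 - p) * ∫ y, f y ∂(μ p) + p * f 0 : ℝ) : ℂ)) (𝓝[>] 0)
        (𝓝 ((∫ y, f y ∂(nessLaw α ν) : ℝ) : ℂ)) := by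
      refine (Complex.continuous_ofReal.tendsto _).comp ?_
      simpa using ((hp.const_sub 1).mul hlim).add (hp.mul_const (f 0))
    refine h3.congr' ?_
    filter_upwards [hI] with p hp
    have hq : ((1 - p : ℝ) : ℂ) ≠ 0 := by exact_mod_cast (by linarith [hp.2] : (1 - p : ℝ) ≠ 0)
    have h4 := ((hsum p hp.1 hp.2).mul_left (1 - p)).add
      ((hasSum_ite_eq (0 : ℤ) (f 0)).mul_left p)
    have h5 := Complex.hasSum_ofReal.2 h4
    refine (h5.congr_fun fun x => ?_).tsum_eq.symm
    have h6 := infinitePropagator_eq_auxPropagator hψ W hp.1 hp.2 x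
    have h7 : auxPropagator ψ W p x = ((1 - p : ℝ) : ℂ) * infinitePropagator ψ W p x +
        p * (if x = 0 then 1 else 0) := by
      rw [h6]; field_simp; ring
    rw [h7]
    by_cases hx : x = 0
    · simp [hx]; ring
    · simp [hx]; ring

/-! ## Densities of the mixture -/

theorem lintegral_comp_mul_left {f : ℝ → ENNReal} (hf : Measurable f) {a : ℝ} (ha : a ≠ 0) :
    ∫⁻ x, f (a * x) = ENNReal.ofReal |a⁻¹| * ∫⁻ x, f x := by
  rw [← lintegral_map hf (measurable_const_mul a), Real.map_volume_mul_left ha,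
    lintegral_smul_measure, smul_eq_mul]

theorem nessLaw_dirac {A : ℝ} (hA : A ≠ 0) :
    nessLaw 1 (Measure.dirac A) = lawOfDensity (exponentialDensity A) := by
  have hme : Measurable (exponentialDensity A) := by
    unfold exponentialDensity
    refine Measurable.ite (measurableSet_le measurable_const (by fun_prop)) (by fun_prop)
      measurable_const
  ext s hs
  rw [nessLaw_apply 1 _ hs, lawOfDensity, withDensity_apply _ hs,
    ← lintegral_indicator measurableSet_Ioi, ← lintegral_indicator hs]
  have hind : Measurable (s.indicator (1 : ℝ → ENNReal)) := measurable_one.indicator hs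
  have hm : Measurable fun x => s.indicator (fun y => ENNReal.ofReal (exponentialDensity A y)) x :=
    hme.ennreal_ofReal.indicator hs
  -- The mixture is the law of $A\tau$; the Jacobian $|A|$ of $y=A\tau$ cancels the prefactor of the
  -- exponential density.
  have h1 := lintegral_comp_mul_left hm hA
  have h2 : ∫⁻ x, s.indicator (fun y => ENNReal.ofReal (exponentialDensity A y)) x =
      ENNReal.ofReal |A| *
        ∫⁻ x, s.indicator (fun y => ENNReal.ofReal (exponentialDensity A y)) (A * x) := by
    rw [h1, ← mul_assoc, ← ENNReal.ofReal_mul (abs_nonneg A), ← abs_mul, mul_inv_cancel₀ hA,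
      abs_one, ENNReal.ofReal_one, one_mul]
  have hm' : Measurable fun x =>
      s.indicator (fun y => ENNReal.ofReal (exponentialDensity A y)) (A * x) :=
    hm.comp (measurable_const_mul A)
  rw [h2, ← lintegral_const_mul _ hm']
  have h0 : ∀ᵐ x : ℝ, x ≠ 0 := by simp [ae_iff]
  refine lintegral_congr_ae ?_
  filter_upwards [h0] with τ hτ
  have hdiv : A * τ / A = τ := mul_div_cancel_left₀ τ hA
  simp only [lintegral_dirac, div_one]
  rcases lt_or_gt_of_ne hτ with hk | hk
  · rw [Set.indicator_of_notMem (by simpa using hk.le)]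
    have : exponentialDensity A (A * τ) = 0 := by
      rw [exponentialDensity, hdiv, if_neg (not_le.2 hk)]
    by_cases hmem : A * τ ∈ s
    · rw [Set.indicator_of_mem hmem, this, ENNReal.ofReal_zero, mul_zero]
    · rw [Set.indicator_of_notMem hmem, mul_zero]
  · rw [Set.indicator_of_mem (by simpa using hk), Real.rpow_one, mul_comm τ A]
    by_cases hmem : A * τ ∈ s
    · have : |A| ≠ 0 := abs_ne_zero.2 hA
      rw [Set.indicator_of_mem hmem, Set.indicator_of_mem hmem, Pi.one_apply, mul_one,
        exponentialDensity, hdiv, if_pos hk.le, ← ENNReal.ofReal_mul (abs_nonneg A)]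
      congr 1
      field_simp
    · rw [Set.indicator_of_notMem hmem, Set.indicator_of_notMem hmem, mul_zero, mul_zero]

section Density

variable {α : ℝ} {L : ℝ → ℝ}

/-- The danger is at $\tau=0$. For $y\ne0$, $e^{-\tau}\tau\le1$ reduces the integrand to
$\tau^{-1/\alpha-1}|L(y\tau^{-1/\alpha})|$, which the substitution $v=\tau^{-1/\alpha}$ turns into
the integrable $L$. For $\alpha>1$, boundedness of $L$ leaves a convergent Gamma integral. -/
theorem integrableOn_nessDensity_integrand (hα : 0 < α) (hc : Continuous L)
    (hi : Integrable L) {C : ℝ} (hC : ∀ y, |L y| ≤ C) {y : ℝ} (hy : y ≠ 0 ∨ 1 < α) :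
    IntegrableOn (fun τ => Real.exp (-τ) * τ ^ (-(1 / α)) * L (y * τ ^ (-(1 / α))))
      (Set.Ioi 0) := by
  have hmeas : AEStronglyMeasurable
      (fun τ : ℝ => Real.exp (-τ) * τ ^ (-(1 / α)) * L (y * τ ^ (-(1 / α))))
      (volume.restrict (Set.Ioi 0)) := by
    have := hc.measurable
    exact Measurable.aestronglyMeasurable (by fun_prop)
  rcases hy with hy | hα1
  · have hne : -(1 / α) ≠ 0 := by simp [hα.ne']
    have h1 := (integrableOn_Ioi_comp_rpow_iff' (fun v => L (y * v)) hne).2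
      ((hi.comp_mul_left' hy).integrableOn)
    refine Integrable.mono (g := fun τ : ℝ => τ ^ (-(1 / α) - 1) • L (y * τ ^ (-(1 / α))))
      h1 hmeas ?_
    filter_upwards [ae_restrict_mem measurableSet_Ioi] with τ hτ
    have hτ' : 0 < τ := hτ
    rw [smul_eq_mul, norm_mul (Real.exp (-τ) * τ ^ (-(1 / α))),
      norm_mul (τ ^ (-(1 / α) - 1))]
    refine mul_le_mul_of_nonneg_right ?_ (norm_nonneg _)
    have h2 : τ ^ (-(1 / α)) = τ * τ ^ (-(1 / α) - 1) := by
      rw [Real.rpow_sub_one hτ'.ne']; field_simp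
    have h3 : 0 < τ ^ (-(1 / α) - 1) := Real.rpow_pos_of_pos hτ' _
    rw [h2, ← mul_assoc, Real.norm_eq_abs, abs_of_pos (by positivity), Real.norm_eq_abs,
      abs_of_pos h3]
    refine mul_le_of_le_one_left h3.le ?_
    rw [Real.exp_neg, inv_mul_le_iff₀ (Real.exp_pos τ), mul_one]
    linarith [Real.add_one_le_exp τ]
  · have h1 : IntegrableOn (fun τ : ℝ => Real.exp (-τ) * τ ^ ((1 - 1 / α) - 1)) (Set.Ioi 0) :=
      Real.GammaIntegral_convergent (by
        rw [sub_pos, div_lt_one hα]; exact hα1)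
    refine Integrable.mono' (h1.mul_const C) hmeas ?_
    filter_upwards [ae_restrict_mem measurableSet_Ioi] with τ hτ
    have h3 : 0 < τ ^ (-(1 / α)) := Real.rpow_pos_of_pos hτ _
    have h4 : (1 - 1 / α) - 1 = -(1 / α) := by ring
    rw [h4, norm_mul, Real.norm_eq_abs, abs_of_pos (by positivity), Real.norm_eq_abs]
    exact mul_le_mul_of_nonneg_left (hC _) (by positivity)

/-- For fixed $\tau$ the substitution $y=\tau^{-1/\alpha}x$ produces the density of
$\tau^{1/\alpha}Y$; Tonelli then integrates over $\tau$. -/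
theorem nessLaw_lawOfDensity (hα : 0 < α) (hc : Continuous L) (hi : Integrable L)
    (h0 : ∀ y, 0 ≤ L y) {C : ℝ} (hC : ∀ y, |L y| ≤ C) [IsProbabilityMeasure (lawOfDensity L)] :
    nessLaw α (lawOfDensity L) = lawOfDensity (nessDensity α L) := by
  have hLm := hc.measurable
  ext s hs
  have hind : Measurable (s.indicator (1 : ℝ → ENNReal)) := measurable_one.indicator hs
  rw [nessLaw_apply α _ hs, lawOfDensity, lawOfDensity, withDensity_apply _ hs]
  have h1 : ∀ τ ∈ Set.Ioi (0 : ℝ), ENNReal.ofReal (Real.exp (-τ)) *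
      ∫⁻ y, s.indicator 1 (τ ^ (1 / α) * y) ∂(volume.withDensity fun y => ENNReal.ofReal (L y)) =
      ∫⁻ x, ENNReal.ofReal (Real.exp (-τ) * τ ^ (-(1 / α)) * L (x * τ ^ (-(1 / α)))) *
        s.indicator 1 x := fun τ hτ => by
    have hτ' : 0 < τ := hτ
    have hr : 0 < τ ^ (-(1 / α)) := Real.rpow_pos_of_pos hτ' _
    have hrr : τ ^ (1 / α) * τ ^ (-(1 / α)) = 1 := by
      rw [← Real.rpow_add hτ', add_neg_cancel, Real.rpow_zero]
    have hm : Measurable fun y => ENNReal.ofReal (L y) * s.indicator 1 (τ ^ (1 / α) * y) :=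
      hLm.ennreal_ofReal.mul (hind.comp (measurable_const_mul _))
    have hi' : Measurable fun y => (s.indicator 1 (τ ^ (1 / α) * y) : ENNReal) :=
      hind.comp (measurable_const_mul _)
    have hm' : Measurable fun x => ENNReal.ofReal (L (τ ^ (-(1 / α)) * x)) *
        s.indicator 1 (τ ^ (1 / α) * (τ ^ (-(1 / α)) * x)) :=
      hm.comp (measurable_const_mul _)
    rw [lintegral_withDensity_eq_lintegral_mul _ hLm.ennreal_ofReal hi']
    have h2 := lintegral_comp_mul_left hm hr.ne'
    have h3 : ∫⁻ y, ENNReal.ofReal (L y) * s.indicator 1 (τ ^ (1 / α) * y) =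
        ENNReal.ofReal (τ ^ (-(1 / α))) * ∫⁻ x, ENNReal.ofReal (L (τ ^ (-(1 / α)) * x)) *
          s.indicator 1 (τ ^ (1 / α) * (τ ^ (-(1 / α)) * x)) := by
      rw [h2, ← mul_assoc, ← ENNReal.ofReal_mul hr.le, abs_of_pos (inv_pos.2 hr),
        mul_inv_cancel₀ hr.ne', ENNReal.ofReal_one, one_mul]
    simp only [Pi.mul_apply]
    rw [h3, ← mul_assoc, ← ENNReal.ofReal_mul (Real.exp_nonneg _),
      ← lintegral_const_mul _ hm']
    refine lintegral_congr fun x => ?_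
    rw [← mul_assoc (τ ^ (1 / α)), hrr, one_mul, ← mul_assoc, ← ENNReal.ofReal_mul (by positivity),
      mul_comm x]
  rw [setLIntegral_congr_fun measurableSet_Ioi h1, lintegral_lintegral_swap]
  · rw [← lintegral_indicator hs]
    -- The origin is discarded: for $\alpha\le1$ the integral defining the mixture density need not
    -- converge there.
    have hne : ∀ᵐ x : ℝ, x ≠ 0 := by simp [ae_iff]
    refine lintegral_congr_ae ?_
    filter_upwards [hne] with x hx
    by_cases hmem : x ∈ s
    · simp only [Set.indicator_of_mem hmem, Pi.one_apply, mul_one]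
      rw [nessDensity, ofReal_integral_eq_lintegral_ofReal
        (integrableOn_nessDensity_integrand hα hc hi hC (Or.inl hx))]
      filter_upwards [ae_restrict_mem measurableSet_Ioi] with τ hτ
      have hr : 0 < τ ^ (-(1 / α)) := Real.rpow_pos_of_pos hτ _
      have := h0 (x * τ ^ (-(1 / α)))
      simp only [Pi.zero_apply]
      positivity
    · simp [Set.indicator_of_notMem hmem]
  · refine Measurable.aemeasurable ?_
    refine Measurable.mul (Measurable.ennreal_ofReal ?_) (hind.comp measurable_snd)
    fun_prop

end Density

/-! ## Fourier representation of the mixture density -/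

theorem integrable_inv_one_add_mul_abs_rpow {α : ℝ} (hα : 1 < α) {b : ℝ} (hb : 0 < b) :
    Integrable fun k : ℝ => 1 / (1 + b * |k| ^ α) := by
  have h1 : Integrable fun k : ℝ => (1 + ‖k‖) ^ (-α) := integrable_one_add_norm (by simpa using hα)
  set m := min 1 b with hm
  have hm0 : 0 < m := lt_min one_pos hb
  refine Integrable.mono' (h1.const_mul (2 ^ α / m)) ?_ (ae_of_all _ fun k => ?_)
  · exact Measurable.aestronglyMeasurable (by fun_prop)
  · have hk : 0 ≤ |k| ^ α := Real.rpow_nonneg (abs_nonneg k) α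
    have h2 : (1 + |k|) ^ α ≤ 2 ^ α * (1 + |k| ^ α) := by
      rcases le_total |k| 1 with h | h
      · calc (1 + |k|) ^ α ≤ 2 ^ α :=
              Real.rpow_le_rpow (by positivity) (by linarith) (by linarith)
          _ ≤ 2 ^ α * (1 + |k| ^ α) := le_mul_of_one_le_right (by positivity) (by linarith)
      · calc (1 + |k|) ^ α ≤ (2 * |k|) ^ α :=
              Real.rpow_le_rpow (by positivity) (by linarith) (by linarith)
          _ = 2 ^ α * |k| ^ α := Real.mul_rpow (by norm_num) (abs_nonneg k)
          _ ≤ 2 ^ α * (1 + |k| ^ α) := mul_le_mul_of_nonneg_left (by linarith) (by positivity)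
    have h3 : m * (1 + |k| ^ α) ≤ 1 + b * |k| ^ α := by
      have := min_le_left 1 b
      have := mul_le_mul_of_nonneg_right (min_le_right 1 b) hk
      rw [mul_add, mul_one]
      linarith
    have h4 : 0 < (1 + |k|) ^ α := Real.rpow_pos_of_pos (by positivity) _
    rw [Real.norm_eq_abs, abs_of_nonneg (by positivity), Real.norm_eq_abs,
      Real.rpow_neg (by positivity), ← div_eq_mul_inv, div_div,
      div_le_div_iff₀ (by positivity) (by positivity), one_mul]
    calc m * (1 + |k|) ^ α ≤ m * (2 ^ α * (1 + |k| ^ α)) := mul_le_mul_of_nonneg_left h2 hm0.le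
      _ = 2 ^ α * (m * (1 + |k| ^ α)) := by ring
      _ ≤ 2 ^ α * (1 + b * |k| ^ α) := mul_le_mul_of_nonneg_left h3 (by positivity)

section Fourier

variable {α θ c : ℝ} {ν : Measure ℝ}

theorem integrable_inv_one_add_stableExponent (hα : 1 < α) (hc : 0 < c)
    (hcos : 0 < Real.cos (Real.pi / 2 * α * θ)) :
    Integrable fun k : ℝ => 1 / (1 + (c : ℂ) * stableExponent α θ k) := by
  have hα0 : 0 < α := by linarith
  refine Integrable.mono' (integrable_inv_one_add_mul_abs_rpow hα (mul_pos hc hcos)) ?_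
    (ae_of_all _ fun k => ?_)
  · have h1 := continuous_stableExponent hα0 θ
    refine Continuous.aestronglyMeasurable (continuous_const.div (by fun_prop) fun k =>
      one_add_ne_zero hα0 hc hcos.le k)
  · have h2 : 1 + c * Real.cos (Real.pi / 2 * α * θ) * |k| ^ α =
        (1 + (c : ℂ) * stableExponent α θ k).re := by
      rw [Complex.add_re, Complex.re_ofReal_mul, re_stableExponent hα0, Complex.one_re]; ring
    rw [norm_div, norm_one, h2]
    exact one_div_le_one_div_of_le (zero_lt_one.trans_le (re_one_add_pos hα0 hc hcos.le k))
      (Complex.re_le_norm _)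

/-- Insert the Fourier integral of the stable density, rescale the frequency by $\tau^{1/\alpha}$ to
absorb the factor $\tau^{-1/\alpha}$, and integrate over $\tau$ first. Fubini needs
$1/(1+b|k|^\alpha)$ integrable, hence $\alpha>1$. -/
theorem HasStableCharFun.nessDensity_eq [IsProbabilityMeasure ν] (hα : 1 < α) (hc : 0 < c)
    (hν : HasStableCharFun α θ c ν) (hcos : 0 < Real.cos (Real.pi / 2 * α * θ)) (y : ℝ) :
    ((nessDensity α (stableDensity α θ c) y : ℝ) : ℂ) =
      fourierDensity (fun k => 1 / (1 + (c : ℂ) * stableExponent α θ k)) y := by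
  have hα0 : 0 < α := by linarith
  have hφ := hν.integrable hα0 hc hcos
  have hSE := continuous_stableExponent hα0 θ
  have h1 : ∀ τ ∈ Set.Ioi (0 : ℝ), ((Real.exp (-τ) * τ ^ (-(1 / α)) *
      stableDensity α θ c (y * τ ^ (-(1 / α))) : ℝ) : ℂ) = 1 / (2 * (Real.pi : ℂ)) *
      ∫ k : ℝ, Complex.exp (Complex.I * k * y) *
        Complex.exp (-((1 + (c : ℂ) * stableExponent α θ k) * τ)) := fun τ hτ => by
    have hτ' : 0 < τ := hτ
    have hr : 0 < τ ^ (1 / α) := Real.rpow_pos_of_pos hτ' _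
    rw [hν.stableDensity_eq, Complex.ofReal_mul, ofReal_re_fourierDensity_charFun hφ,
      fourierDensity]
    have h2 := Measure.integral_comp_mul_left (fun u : ℝ =>
      Complex.exp (Complex.I * u * (y * τ ^ (-(1 / α)) : ℝ)) * charFun ν (-u)) (τ ^ (1 / α))
    rw [abs_of_pos (inv_pos.2 hr), ← Real.rpow_neg hτ'.le, Complex.real_smul] at h2
    rw [Complex.ofReal_mul, mul_mul_mul_comm, mul_comm ((Real.exp (-τ) : ℝ) : ℂ), mul_assoc, ← h2,
      ← integral_const_mul]
    congr 1
    refine integral_congr_ae (ae_of_all _ fun k => ?_)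
    simp only
    rw [hν, stableExponent_rpow_mul hα0 θ hτ', Complex.ofReal_exp, ← Complex.exp_add,
      ← Complex.exp_add, ← Complex.exp_add]
    congr 1
    have h3 : ((τ ^ (1 / α) : ℝ) : ℂ) * ((τ ^ (-(1 / α)) : ℝ) : ℂ) = 1 := by
      rw [← Complex.ofReal_mul, ← Real.rpow_add hτ', add_neg_cancel, Real.rpow_zero,
        Complex.ofReal_one]
    push_cast at h3 ⊢
    linear_combination (Complex.I * k * y) * h3
  have hint : Integrable (Function.uncurry fun (τ k : ℝ) => Complex.exp (Complex.I * k * y) *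
      Complex.exp (-((1 + (c : ℂ) * stableExponent α θ k) * τ)))
      ((volume.restrict (Set.Ioi 0)).prod volume) := by
    have hnorm : ∀ τ k : ℝ, ‖Complex.exp (Complex.I * k * y) *
        Complex.exp (-((1 + (c : ℂ) * stableExponent α θ k) * τ))‖ =
          Real.exp (-(1 + c * Real.cos (Real.pi / 2 * α * θ) * |k| ^ α) * τ) := fun τ k => by
      rw [norm_mul, norm_cexp_I_mul_mul, one_mul, Complex.norm_exp]
      congr 1
      rw [Complex.neg_re, Complex.re_mul_ofReal, Complex.add_re, Complex.re_ofReal_mul,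
        re_stableExponent hα0, Complex.one_re]
      ring
    have hpos : ∀ k : ℝ, 0 < 1 + c * Real.cos (Real.pi / 2 * α * θ) * |k| ^ α := fun k => by
      have := Real.rpow_nonneg (abs_nonneg k) α
      positivity
    have hmeas : AEStronglyMeasurable (Function.uncurry fun (τ k : ℝ) =>
        Complex.exp (Complex.I * k * y) *
          Complex.exp (-((1 + (c : ℂ) * stableExponent α θ k) * τ)))
        ((volume.restrict (Set.Ioi 0)).prod volume) := by
      refine Continuous.aestronglyMeasurable ?_
      unfold Function.uncurry
      fun_prop
    rw [integrable_prod_iff' hmeas]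
    refine ⟨ae_of_all _ fun k => ?_, ?_⟩
    · refine Integrable.mono' (integrableOn_exp_mul_Ioi (neg_lt_zero.2 (hpos k)) 0)
        (Continuous.aestronglyMeasurable ?_) (ae_of_all _ fun τ => (hnorm τ k).le)
      simp only [Function.uncurry]
      fun_prop
    · refine (integrable_inv_one_add_mul_abs_rpow hα (mul_pos hc hcos)).congr
        (ae_of_all _ fun k => ?_)
      simp only [Function.uncurry]
      simp_rw [hnorm]
      rw [integral_exp_mul_Ioi (neg_lt_zero.2 (hpos k)), mul_zero, Real.exp_zero, neg_div_neg_eq]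
  rw [nessDensity, ← integral_complex_ofReal, setIntegral_congr_fun measurableSet_Ioi h1,
    integral_const_mul, integral_integral_swap hint, fourierDensity]
  congr 1
  refine integral_congr_ae (ae_of_all _ fun k => ?_)
  simp only
  rw [integral_const_mul, integral_cexp_neg_mul_Ioi
    (zero_lt_one.trans_le (re_one_add_pos hα0 hc hcos.le k))]

end Fourier

/-! ## A lower bound for the characteristic function of the steps -/

theorem re_one_sub_stepCharFun (W : PMF ℤ) (φ : ℝ) :
    (1 - stepCharFun W φ).re = ∫ x : ℤ, (1 - Real.cos (φ * x)) ∂W.toMeasure := by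
  have hcos : Integrable (fun x : ℤ => Real.cos (φ * x)) W.toMeasure :=
    Integrable.of_bound Measurable.of_discrete.aestronglyMeasurable 1
      (ae_of_all _ fun x => Real.abs_cos_le_one _)
  rw [integral_sub (integrable_const _) hcos, stepCharFun_eq_integral, Complex.sub_re,
    Complex.one_re]
  have h := integral_re (integrable_cexp_int W.toMeasure φ)
  simp only [RCLike.re_to_complex] at h
  rw [← h]
  congr 1
  · simp
  · refine integral_congr_ae (ae_of_all _ fun x => ?_)
    have : -(Complex.I * φ * x) = ((-(φ * x) : ℝ) : ℂ) * Complex.I := by push_cast; ring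
    simp only
    rw [this, Complex.exp_ofReal_mul_I_re, Real.cos_neg]

/-- If the integral of $1-\cos(\varphi x)$ vanishes, then $\varphi x\in2\pi\mathbb Z$ on the
support, hence on the group it generates, hence at $x=1$; with $|\varphi|\le\pi$ this leaves only
$\varphi=0$. -/
theorem re_one_sub_stepCharFun_pos {W : PMF ℤ} (hW : AddSubgroup.closure W.support = ⊤) {φ : ℝ}
    (h0 : φ ≠ 0) (hπ : |φ| ≤ Real.pi) : 0 < (1 - stepCharFun W φ).re := by
  have hnn : ∀ x : ℤ, 0 ≤ 1 - Real.cos (φ * x) := fun x => by linarith [Real.cos_le_one (φ * x)]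
  rw [re_one_sub_stepCharFun]
  refine lt_of_le_of_ne (integral_nonneg hnn) fun h => h0 ?_
  have hi : Integrable (fun x : ℤ => 1 - Real.cos (φ * x)) W.toMeasure :=
    (integrable_const _).sub (Integrable.of_bound Measurable.of_discrete.aestronglyMeasurable 1
      (ae_of_all _ fun x => Real.abs_cos_le_one _))
  have hae := (integral_eq_zero_iff_of_nonneg hnn hi).1 h.symm
  have hsupp : ∀ x ∈ W.support, ∃ n : ℤ, (n : ℝ) * (2 * Real.pi) = φ * x := fun x hx => by
    by_contra hne
    have hc : Real.cos (φ * x) ≠ 1 := fun hc => hne ((Real.cos_eq_one_iff _).1 hc)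
    have h1 : W.toMeasure {x} = 0 := by
      refine measure_mono_null (fun z hz => ?_) hae
      rw [Set.mem_singleton_iff.1 hz]
      intro hz'
      have hz2 : 1 - Real.cos (φ * x) = 0 := hz'
      exact hc (by linarith)
    rw [PMF.toMeasure_apply_singleton _ _ (measurableSet_singleton x)] at h1
    exact (W.mem_support_iff x).1 hx h1
  have h1 : (1 : ℤ) ∈ AddSubgroup.closure W.support := by rw [hW]; trivial
  have hall : ∀ z ∈ AddSubgroup.closure W.support, ∃ n : ℤ, (n : ℝ) * (2 * Real.pi) = φ * z := by
    intro z hz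
    induction hz using AddSubgroup.closure_induction with
    | mem x hx => exact hsupp x hx
    | zero => exact ⟨0, by simp⟩
    | add x y _ _ hx hy =>
      obtain ⟨m, hm⟩ := hx
      obtain ⟨n, hn⟩ := hy
      exact ⟨m + n, by push_cast; rw [add_mul, mul_add, hm, hn]⟩
    | neg x _ hx =>
      obtain ⟨m, hm⟩ := hx
      exact ⟨-m, by push_cast; rw [neg_mul, mul_neg, hm]⟩
  obtain ⟨n, hn⟩ := hall 1 h1
  rw [Int.cast_one, mul_one] at hn
  have hn0 : n = 0 := by
    rw [← hn, abs_mul, abs_of_pos Real.two_pi_pos] at hπ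
    have : |(n : ℝ)| < 1 := by
      by_contra! hge
      nlinarith [Real.pi_pos]
    exact Int.abs_lt_one_iff.1 (by exact_mod_cast this)
  rw [← hn, hn0]; simp

/-- Near $0$ the expansion gives half of its leading coefficient; away from $0$ the continuous real
part has a positive minimum by compactness. The bound supplies the domination for the local theorem.
-/
theorem exists_le_re_one_sub_stepCharFun {W : PMF ℤ} {α θ c : ℝ} (hα : 0 < α) (hc : 0 < c)
    (hW : StepExpansion W α θ c) (hcos : 0 < Real.cos (Real.pi / 2 * α * θ))
    (hsupp : AddSubgroup.closure W.support = ⊤) :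
    ∃ κ : ℝ, 0 < κ ∧ ∀ φ : ℝ, |φ| ≤ Real.pi → κ * |φ| ^ α ≤ (1 - stepCharFun W φ).re := by
  set b := c * Real.cos (Real.pi / 2 * α * θ) with hb
  have hb0 : 0 < b := mul_pos hc hcos
  obtain ⟨δ, hδ, hnear⟩ := Metric.eventually_nhds_iff.1 (hW.def (half_pos hb0))
  have hcompact : IsCompact (Set.Icc (-Real.pi) Real.pi ∩ {φ : ℝ | δ ≤ |φ|}) :=
    isCompact_Icc.inter_right (isClosed_le continuous_const continuous_abs)
  have hcont : Continuous fun φ => (1 - stepCharFun W φ).re :=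
    Complex.continuous_re.comp (continuous_const.sub (continuous_stepCharFun W))
  obtain ⟨m, hm, hfar⟩ := hcompact.exists_forall_le' hcont.continuousOn (a := 0) fun φ hφ =>
    re_one_sub_stepCharFun_pos hsupp (fun h => by
      have : δ ≤ |φ| := hφ.2
      rw [h, abs_zero] at this; linarith) (abs_le.2 hφ.1)
  have hπ : 0 < Real.pi ^ α := Real.rpow_pos_of_pos Real.pi_pos α
  refine ⟨min (b / 2) (m / Real.pi ^ α), lt_min (half_pos hb0) (by positivity), fun φ hφ => ?_⟩
  have hφ0 : 0 ≤ |φ| ^ α := Real.rpow_nonneg (abs_nonneg φ) α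
  rcases lt_or_ge |φ| δ with h | h
  · refine (mul_le_mul_of_nonneg_right (min_le_left _ _) hφ0).trans ?_
    have h1 := hnear (y := φ) (by simpa using h)
    rw [Real.norm_eq_abs, abs_of_nonneg hφ0] at h1
    have h2 := (Complex.re_le_norm _).trans h1
    rw [Complex.sub_re, Complex.sub_re, Complex.re_ofReal_mul, re_stableExponent hα,
      Complex.one_re] at h2
    rw [Complex.sub_re, Complex.one_re]
    have h3 : c * (|φ| ^ α * Real.cos (Real.pi / 2 * α * θ)) = b * |φ| ^ α := by rw [hb]; ring
    rw [h3] at h2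
    linarith
  · refine (mul_le_mul_of_nonneg_right (min_le_right _ _) hφ0).trans ?_
    refine le_trans ?_ (hfar φ ⟨abs_le.1 hφ, h⟩)
    rw [div_mul_eq_mul_div, div_le_iff₀ hπ]
    exact mul_le_mul_of_nonneg_left (Real.rpow_le_rpow (abs_nonneg φ) hφ hα.le) hm.le

/-! ## Local convergence -/

/-- The integrand of the rescaled auxiliary propagator. -/
noncomputable def rescaledSymbol (ψ : PMF ℕ) (W : PMF ℤ) (p R : ℝ) : ℝ → ℂ :=
  (Set.Ioc (-(Real.pi * R)) (Real.pi * R)).indicator fun k =>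
    ((1 - waitingGF ψ (1 - p) : ℝ) : ℂ) / (1 - stepCharFun W (k / R) * waitingGF ψ (1 - p))

/-- The substitution $\varphi=k/R$ writes the lattice integral as an integral over the whole line of
a symbol cut off at $\pi R$, comparable with the limiting one. -/
theorem mul_auxPropagator_eq (ψ : PMF ℕ) (W : PMF ℤ) (p : ℝ) {R : ℝ} (hR : 0 < R) (x : ℤ) :
    (R : ℂ) * auxPropagator ψ W p x = fourierDensity (rescaledSymbol ψ W p R) (x / R) := by
  have h1 := intervalIntegral.integral_comp_div (a := -(Real.pi * R)) (b := Real.pi * R)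
    (fun φ : ℝ => Complex.exp (Complex.I * φ * x) /
      (1 - stepCharFun W φ * (waitingGF ψ (1 - p) : ℂ))) hR.ne'
  rw [neg_div, mul_div_cancel_right₀ _ hR.ne', Complex.real_smul] at h1
  have hRc : (R : ℂ) ≠ 0 := by exact_mod_cast hR.ne'
  rw [auxPropagator, mul_left_comm, ← h1, intervalIntegral.integral_of_le (by
    have := mul_pos Real.pi_pos hR; linarith), ← integral_indicator measurableSet_Ioc,
    fourierDensity, div_mul_eq_mul_div, mul_comm (((1 - waitingGF ψ (1 - p) : ℝ)) : ℂ),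
    ← integral_mul_const, div_eq_mul_inv, mul_comm, one_div]
  congr 1
  refine integral_congr_ae (ae_of_all _ fun k => ?_)
  simp only [rescaledSymbol, Set.indicator_apply]
  split_ifs
  · have : Complex.I * ((k / R : ℝ) : ℂ) * x = Complex.I * k * ((x / R : ℝ) : ℂ) := by
      push_cast; ring
    rw [this]; ring
  · simp

theorem fourierDensity_sub {φ χ : ℝ → ℂ} (hφ : Integrable φ) (hχ : Integrable χ) (y : ℝ) :
    fourierDensity φ y - fourierDensity χ y = fourierDensity (fun k => φ k - χ k) y := by
  simp only [fourierDensity]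
  rw [← mul_sub, ← integral_sub (integrable_cexp_mul hφ y) (integrable_cexp_mul hχ y)]
  congr 2
  ext k
  ring

theorem continuous_symbol {ψ : PMF ℕ} (hψ : ψ 0 = 0) (W : PMF ℤ) {p : ℝ} (hp : 0 < p)
    (hp1 : p < 1) (R : ℝ) : Continuous fun k : ℝ => ((1 - waitingGF ψ (1 - p) : ℝ) : ℂ) /
      (1 - stepCharFun W (k / R) * waitingGF ψ (1 - p)) :=
  continuous_const.div (by fun_prop) fun k =>
    one_sub_mul_waitingGF_ne_zero hψ hp hp1 (norm_stepCharFun_le W _)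

/-- The denominator has real part $(1-g)+g\,\mathrm{Re}(1-\hat W)\ge(1-g)+\frac\kappa2|k|^\alpha/s$,
and $1/s\ge(1-g)/2$. The two halves make $\kappa/4$, and $1-g$ cancels. -/
theorem norm_rescaledSymbol_le {W : PMF ℤ} {α : ℝ} (hα : 0 < α) {κ : ℝ} (hκ : 0 < κ)
    (hbound : ∀ φ : ℝ, |φ| ≤ Real.pi → κ * |φ| ^ α ≤ (1 - stepCharFun W φ).re)
    {ψ : PMF ℕ} {p s : ℝ} (hs : 0 < s) (hg : 1 / 2 ≤ waitingGF ψ (1 - p))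
    (hg1 : waitingGF ψ (1 - p) < 1) (hsg : s * (1 - waitingGF ψ (1 - p)) ≤ 2) (k : ℝ) :
    ‖rescaledSymbol ψ W p (s ^ (1 / α)) k‖ ≤ 1 / (1 + κ / 4 * |k| ^ α) := by
  set g := waitingGF ψ (1 - p) with hgdef
  have hR : 0 < s ^ (1 / α) := Real.rpow_pos_of_pos hs _
  have hk0 : 0 ≤ |k| ^ α := Real.rpow_nonneg (abs_nonneg k) α
  have hg' : 0 < 1 - g := by linarith
  by_cases hk : k ∈ Set.Ioc (-(Real.pi * s ^ (1 / α))) (Real.pi * s ^ (1 / α))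
  · rw [rescaledSymbol, Set.indicator_of_mem hk]
    have h1 : |k / s ^ (1 / α)| ≤ Real.pi := by
      rw [abs_div, abs_of_pos hR, div_le_iff₀ hR]
      exact abs_le.2 ⟨hk.1.le, hk.2⟩
    have h2 := hbound _ h1
    rw [abs_div, abs_of_pos hR, Real.div_rpow (abs_nonneg k) hR.le,
      rpow_one_div_rpow hα hs.le] at h2
    have h3 : (1 - g) * (1 + κ / 4 * |k| ^ α) ≤
        (1 - stepCharFun W (k / s ^ (1 / α)) * (g : ℂ)).re := by
      have h4 : (1 - stepCharFun W (k / s ^ (1 / α)) * (g : ℂ)).re =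
          (1 - g) + g * (1 - stepCharFun W (k / s ^ (1 / α))).re := by
        rw [Complex.sub_re, Complex.sub_re, Complex.re_mul_ofReal, Complex.one_re]; ring
      rw [h4]
      have h5 : (1 - g) * (κ / 4 * |k| ^ α) ≤ 1 / 2 * (κ * (|k| ^ α / s)) := by
        have h6 : (1 - g) ≤ 2 / s := by rw [le_div_iff₀ hs]; linarith
        calc (1 - g) * (κ / 4 * |k| ^ α) ≤ 2 / s * (κ / 4 * |k| ^ α) :=
              mul_le_mul_of_nonneg_right h6 (by positivity)
          _ = 1 / 2 * (κ * (|k| ^ α / s)) := by ring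
      have h7 : 1 / 2 * (κ * (|k| ^ α / s)) ≤ g * (1 - stepCharFun W (k / s ^ (1 / α))).re :=
        mul_le_mul hg h2 (by positivity) (by linarith)
      linarith
    have h8 : 0 < (1 - g) * (1 + κ / 4 * |k| ^ α) := by positivity
    rw [norm_div, Complex.norm_real, Real.norm_eq_abs, abs_of_pos hg',
      div_le_div_iff₀ (h8.trans_le (h3.trans (Complex.re_le_norm _))) (by positivity), one_mul]
    exact h3.trans (Complex.re_le_norm _)
  · rw [rescaledSymbol, Set.indicator_of_notMem hk, norm_zero]
    positivity

theorem aestronglyMeasurable_rescaledSymbol {ψ : PMF ℕ} (hψ : ψ 0 = 0) (W : PMF ℤ) {p : ℝ}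
    (hp : 0 < p) (hp1 : p < 1) (R : ℝ) : AEStronglyMeasurable (rescaledSymbol ψ W p R) :=
  (continuous_symbol hψ W hp hp1 R).aestronglyMeasurable.indicator measurableSet_Ioc

/-- The symbols of the rescaled auxiliary propagators converge in mean. -/
theorem tendsto_integral_norm_rescaledSymbol_sub {W : PMF ℤ} {α θ c : ℝ} (hα : 1 < α) (hc : 0 < c)
    (hW : StepExpansion W α θ c) (hcos : 0 < Real.cos (Real.pi / 2 * α * θ))
    (hsupp : AddSubgroup.closure W.support = ⊤) {ψ : PMF ℕ} (hψ : ψ 0 = 0) {s : ℝ → ℝ}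
    (hs : IsScaling ψ s) :
    (∀ᶠ p in 𝓝[>] 0, Integrable (rescaledSymbol ψ W p (s p ^ (1 / α)))) ∧
    Tendsto (fun p => ∫ k, ‖rescaledSymbol ψ W p (s p ^ (1 / α)) k -
      1 / (1 + (c : ℂ) * stableExponent α θ k)‖) (𝓝[>] 0) (𝓝 0) := by
  have hα0 : 0 < α := by linarith
  obtain ⟨κ, hκ, hbound⟩ := exists_le_re_one_sub_stepCharFun hα0 hc hW hcos hsupp
  obtain ⟨h1, h2⟩ := tendsto_atTop_of_isScaling hψ hs
  have hQ := integrable_inv_one_add_stableExponent hα hc hcos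
  have hdom := integrable_inv_one_add_mul_abs_rpow hα (by positivity : 0 < κ / 4)
  have hev : ∀ᶠ p in 𝓝[>] (0 : ℝ), AEStronglyMeasurable (rescaledSymbol ψ W p (s p ^ (1 / α))) ∧
      ∀ k, ‖rescaledSymbol ψ W p (s p ^ (1 / α)) k‖ ≤ 1 / (1 + κ / 4 * |k| ^ α) := by
    filter_upwards [Ioo_mem_nhdsGT (zero_lt_one' ℝ), h2.eventually_gt_atTop 0,
      (tendsto_waitingGF ψ).eventually_const_le (by norm_num : (1 / 2 : ℝ) < 1),
      h1.eventually_le_const (by norm_num : (1 : ℝ) < 2)] with p hp hsp hg hsg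
    exact ⟨aestronglyMeasurable_rescaledSymbol hψ W hp.1 hp.2 _,
      norm_rescaledSymbol_le hα0 hκ hbound hsp hg (waitingGF_lt_one hψ hp.1 hp.2) hsg⟩
  refine ⟨hev.mono fun p hp => hdom.mono' hp.1 (ae_of_all _ hp.2), ?_⟩
  rw [show 𝓝 (0 : ℝ) = 𝓝 (∫ _ : ℝ, (0 : ℝ)) by rw [integral_zero]]
  refine tendsto_integral_filter_of_dominated_convergence
    (fun k => 1 / (1 + κ / 4 * |k| ^ α) + ‖1 / (1 + (c : ℂ) * stableExponent α θ k)‖)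
    (hev.mono fun p hp => (hp.1.sub hQ.1).norm)
    (hev.mono fun p hp => ae_of_all _ fun k => ?_) (hdom.add hQ.norm) (ae_of_all _ fun k => ?_)
  · rw [norm_norm]
    exact (norm_sub_le _ _).trans (add_le_add_left (hp.2 k) _)
  · refine tendsto_zero_iff_norm_tendsto_zero.1 (tendsto_sub_nhds_zero_iff.2 ?_)
    refine (tendsto_geometric_stepCharFun hα0 hc hW hcos.le hψ hs k).congr' ?_
    have hR : Tendsto (fun p => Real.pi * s p ^ (1 / α)) (𝓝[>] 0) atTop :=
      ((tendsto_rpow_atTop (by positivity)).comp h2).const_mul_atTop Real.pi_pos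
    filter_upwards [hR.eventually_gt_atTop |k|] with p hp
    have h3 : k ∈ Set.Ioc (-(Real.pi * s p ^ (1 / α))) (Real.pi * s p ^ (1 / α)) :=
      ⟨(abs_lt.1 hp).1, (abs_lt.1 hp).2.le⟩
    rw [rescaledSymbol, Set.indicator_of_mem h3]

/-- Waiting times of at least one give $\bar\psi(q)\le q$, so $p\le1-g$ and eventually
$\lambda\le2/p$. Thus $\lambda^{1/\alpha}p=O(p^{1-1/\alpha})$, which vanishes because $\alpha>1$. -/
theorem tendsto_rpow_scaling_mul {α : ℝ} (hα : 1 < α) {ψ : PMF ℕ} (hψ : ψ 0 = 0) {s : ℝ → ℝ}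
    (hs : IsScaling ψ s) : Tendsto (fun p => s p ^ (1 / α) * p) (𝓝[>] 0) (𝓝 0) := by
  have hα0 : 0 < α := by linarith
  obtain ⟨h1, h2⟩ := tendsto_atTop_of_isScaling hψ hs
  have hexp : 0 < 1 - 1 / α := by rw [sub_pos, div_lt_one hα0]; exact hα
  have h3 : Tendsto (fun p : ℝ => (2 : ℝ) ^ (1 / α) * p ^ (1 - 1 / α)) (𝓝[>] 0) (𝓝 0) := by
    have h4 : Tendsto (fun p : ℝ => p ^ (1 - 1 / α)) (𝓝[>] 0) (𝓝 0) := by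
      have := (Real.continuousAt_rpow_const 0 (1 - 1 / α) (Or.inr hexp.le)).tendsto
      rw [Real.zero_rpow hexp.ne'] at this
      exact this.mono_left nhdsWithin_le_nhds
    simpa using h4.const_mul ((2 : ℝ) ^ (1 / α))
  refine tendsto_of_tendsto_of_tendsto_of_le_of_le' tendsto_const_nhds h3 ?_ ?_
  · filter_upwards [Ioo_mem_nhdsGT (zero_lt_one' ℝ), h2.eventually_gt_atTop 0] with p hp hsp
    have := hp.1
    positivity
  · filter_upwards [Ioo_mem_nhdsGT (zero_lt_one' ℝ), h2.eventually_gt_atTop 0,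
      h1.eventually_le_const (by norm_num : (1 : ℝ) < 2)] with p hp hsp hsg
    have hp0 := hp.1
    have h5 : p ≤ 1 - waitingGF ψ (1 - p) := by
      have := waitingGF_le hψ (u := 1 - p) (by linarith [hp.2]) (by linarith)
      linarith
    have h6 : s p ≤ 2 / p := by
      rw [le_div_iff₀ hp0]
      exact (mul_le_mul_of_nonneg_left h5 hsp.le).trans hsg
    calc s p ^ (1 / α) * p ≤ (2 / p) ^ (1 / α) * p :=
          mul_le_mul_of_nonneg_right (Real.rpow_le_rpow hsp.le h6 (by positivity)) hp0.le
      _ = (2 : ℝ) ^ (1 / α) * p ^ (1 - 1 / α) := by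
          rw [Real.div_rpow (by norm_num) hp0.le, Real.rpow_sub hp0, Real.rpow_one]
          ring

/-- Two functions given by Fourier inversion differ uniformly by at most $1/2\pi$ times the $L^1$
distance of their symbols, and this distance tends to $0$. -/
theorem HasStableCharFun.convergesLocally {W : PMF ℤ} {α θ c : ℝ} {ν : Measure ℝ}
    [IsProbabilityMeasure ν] (hα : 1 < α) (hc : 0 < c) (hW : StepExpansion W α θ c)
    (hν : HasStableCharFun α θ c ν) (hcos : 0 < Real.cos (Real.pi / 2 * α * θ))
    (hsupp : AddSubgroup.closure W.support = ⊤) :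
    ConvergesLocally W α (nessDensity α (stableDensity α θ c)) := by
  intro ψ hψ s hs ε hε
  obtain ⟨hint, hlim⟩ := tendsto_integral_norm_rescaledSymbol_sub hα hc hW hcos hsupp hψ hs
  obtain ⟨-, h2⟩ := tendsto_atTop_of_isScaling hψ hs
  have hQ := integrable_inv_one_add_stableExponent hα hc hcos
  set D : ℝ → ℝ := fun p => 1 / (2 * Real.pi) *
    ∫ k, ‖rescaledSymbol ψ W p (s p ^ (1 / α)) k - 1 / (1 + (c : ℂ) * stableExponent α θ k)‖
  set C : ℝ := 1 / (2 * Real.pi) * ∫ k, ‖1 / (1 + (c : ℂ) * stableExponent α θ k)‖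
  have hD : Tendsto D (𝓝[>] 0) (𝓝 0) := by
    have := hlim.const_mul (1 / (2 * Real.pi))
    rwa [mul_zero] at this
  have hp0 : Tendsto (fun p : ℝ => p) (𝓝[>] 0) (𝓝 0) := tendsto_id.mono_left nhdsWithin_le_nhds
  -- The three errors for $P$: that of $P_q$ divided by $q$, the factor $1/q-1=p/q$ on the bounded
  -- limit density, and the rescaled atom at the origin.
  have hE : Tendsto (fun p => 1 / (1 - p) * D p + p / (1 - p) * C +
      s p ^ (1 / α) * p / (1 - p)) (𝓝[>] 0) (𝓝 0) := by
    have hq := hp0.const_sub 1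
    have h3 := (((tendsto_const_nhds (x := (1 : ℝ))).div hq (by norm_num)).mul hD).add
      ((hp0.div hq (by norm_num)).mul_const C)
    simpa using h3.add ((tendsto_rpow_scaling_mul hα hψ hs).div hq (by norm_num))
  filter_upwards [Ioo_mem_nhdsGT (zero_lt_one' ℝ), h2.eventually_gt_atTop 0, hint,
    hD.eventually_le_const hε, hE.eventually_le_const hε] with p hp hsp hpi hDε hEε x
  set R := s p ^ (1 / α)
  have hR : 0 < R := Real.rpow_pos_of_pos hsp _
  have haux : ‖(R : ℂ) * auxPropagator ψ W p x -
      (nessDensity α (stableDensity α θ c) (x / R) : ℂ)‖ ≤ D p := by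
    rw [mul_auxPropagator_eq ψ W p hR, hν.nessDensity_eq hα hc hcos, fourierDensity_sub hpi hQ]
    exact norm_fourierDensity_le _ _
  have hC : ‖(nessDensity α (stableDensity α θ c) (x / R) : ℂ)‖ ≤ C := by
    rw [hν.nessDensity_eq hα hc hcos]
    exact norm_fourierDensity_le _ _
  refine ⟨?_, haux.trans hDε⟩
  refine le_trans ?_ hEε
  have hq : 0 < 1 - p := by linarith [hp.2]
  have hqc : ((1 - p : ℝ) : ℂ) ≠ 0 := by exact_mod_cast hq.ne'
  have key : ((R * infinitePropagator ψ W p x -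
      nessDensity α (stableDensity α θ c) (x / R) : ℝ) : ℂ) =
      1 / ((1 - p : ℝ) : ℂ) * ((R : ℂ) * auxPropagator ψ W p x -
        (nessDensity α (stableDensity α θ c) (x / R) : ℂ)) +
      ((p / (1 - p) : ℝ) : ℂ) * (nessDensity α (stableDensity α θ c) (x / R) : ℂ) -
      ((R * p / (1 - p) : ℝ) : ℂ) * (if x = 0 then 1 else 0) := by
    rw [Complex.ofReal_sub, Complex.ofReal_mul,
      infinitePropagator_eq_auxPropagator hψ W hp.1 hp.2 x, Complex.ofReal_div,
      Complex.ofReal_div, Complex.ofReal_mul]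
    generalize auxPropagator ψ W p x = a
    generalize ((nessDensity α (stableDensity α θ c) (x / R) : ℝ) : ℂ) = n
    generalize (if x = 0 then (1 : ℂ) else 0) = d
    field_simp
    push_cast
    ring
  have hδ : ‖(if x = 0 then 1 else 0 : ℂ)‖ ≤ 1 := by split_ifs <;> simp
  have hpq : 0 ≤ p / (1 - p) := div_nonneg hp.1.le hq.le
  have hRp : 0 ≤ R * p / (1 - p) := div_nonneg (mul_nonneg hR.le hp.1.le) hq.le
  rw [← Real.norm_eq_abs, ← Complex.norm_real, key]
  refine (norm_sub_le _ _).trans (add_le_add ((norm_add_le _ _).trans (add_le_add ?_ ?_)) ?_)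
  · rw [norm_mul, norm_div, norm_one, Complex.norm_real, Real.norm_eq_abs, abs_of_pos hq]
    exact mul_le_mul_of_nonneg_left haux (by positivity)
  · rw [norm_mul, Complex.norm_real, Real.norm_eq_abs, abs_of_nonneg hpq]
    exact mul_le_mul_of_nonneg_left hC hpq
  · rw [norm_mul, Complex.norm_real, Real.norm_eq_abs, abs_of_nonneg hRp]
    exact mul_le_of_le_one_right hRp hδ

/-! ## Densities of the stable law and of the mixture -/

section

variable {α θ c : ℝ} {ν : Measure ℝ}

theorem HasStableCharFun.continuous_stableDensity [IsProbabilityMeasure ν] (hα : 0 < α) (hc : 0 < c)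
    (hν : HasStableCharFun α θ c ν) (hcos : 0 < Real.cos (Real.pi / 2 * α * θ)) :
    Continuous (stableDensity α θ c) := by
  rw [funext hν.stableDensity_eq]
  exact Complex.continuous_re.comp (continuous_fourierDensity (hν.integrable hα hc hcos))

theorem HasStableCharFun.integrable_stableDensity [IsProbabilityMeasure ν] (hα : 0 < α) (hc : 0 < c)
    (hν : HasStableCharFun α θ c ν) (hcos : 0 < Real.cos (Real.pi / 2 * α * θ)) :
    Integrable (stableDensity α θ c) := by
  rw [funext hν.stableDensity_eq]
  exact integrable_re_fourierDensity_charFun (hν.integrable hα hc hcos)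

theorem HasStableCharFun.stableDensity_nonneg [IsProbabilityMeasure ν] (hα : 0 < α) (hc : 0 < c)
    (hν : HasStableCharFun α θ c ν) (hcos : 0 < Real.cos (Real.pi / 2 * α * θ)) (y : ℝ) :
    0 ≤ stableDensity α θ c y := by
  rw [hν.stableDensity_eq]
  exact fourierDensity_charFun_nonneg (hν.integrable hα hc hcos) y

theorem HasStableCharFun.abs_stableDensity_le (hν : HasStableCharFun α θ c ν) (y : ℝ) :
    |stableDensity α θ c y| ≤ 1 / (2 * Real.pi) * ∫ k, ‖charFun ν (-k)‖ := by
  rw [hν.stableDensity_eq]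
  exact (Complex.abs_re_le_norm _).trans (norm_fourierDensity_le _ y)

theorem HasStableCharFun.eq_lawOfDensity [IsProbabilityMeasure ν] (hα : 0 < α) (hc : 0 < c)
    (hν : HasStableCharFun α θ c ν) (hcos : 0 < Real.cos (Real.pi / 2 * α * θ)) :
    ν = lawOfDensity (stableDensity α θ c) := by
  rw [funext hν.stableDensity_eq]
  exact eq_lawOfDensity_fourierDensity (hν.integrable hα hc hcos)

theorem HasStableCharFun.nessLaw_eq [IsProbabilityMeasure ν] (hα : 0 < α) (hc : 0 < c)
    (hν : HasStableCharFun α θ c ν) (hcos : 0 < Real.cos (Real.pi / 2 * α * θ)) :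
    nessLaw α ν = lawOfDensity (nessDensity α (stableDensity α θ c)) := by
  have h := hν.eq_lawOfDensity hα hc hcos
  have : IsProbabilityMeasure (lawOfDensity (stableDensity α θ c)) := h ▸ inferInstance
  rw [h]
  exact nessLaw_lawOfDensity hα (hν.continuous_stableDensity hα hc hcos)
    (hν.integrable_stableDensity hα hc hcos) (hν.stableDensity_nonneg hα hc hcos)
    hν.abs_stableDensity_le

end

/-! ## Expansions from moments -/

theorem stepCharFun_taylor {W : PMF ℤ} {n : ℕ} (h : MemLp id n (stepLaw W)) :
    (fun φ : ℝ => stepCharFun W φ - ∑ k ∈ Finset.range (n + 1),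
      (k.factorial : ℂ)⁻¹ * ((-φ : ℝ) * Complex.I) ^ k * ∫ x : ℝ, x ^ k ∂(stepLaw W))
      =o[𝓝 0] fun φ : ℝ => |φ| ^ n := by
  have h1 := taylor_isLittleO_univ (x₀ := 0) (contDiff_charFun h)
  simp_rw [taylorWithinEval_charFun_zero h, sub_zero] at h1
  have h2 : Tendsto (fun φ : ℝ => -φ) (𝓝 0) (𝓝 0) := by
    simpa using (continuous_neg (G := ℝ)).tendsto 0
  have h3 := (h1.comp_tendsto h2).norm_right
  refine (h3.congr_left fun φ => ?_).congr_right fun φ => ?_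
  · simp only [Function.comp_apply]
    rw [stepCharFun_eq_charFun]
  · simp

theorem integral_stepLaw (W : PMF ℤ) (n : ℕ) :
    ∫ x : ℝ, x ^ n ∂(stepLaw W) = ∫ x : ℤ, (x : ℝ) ^ n ∂W.toMeasure :=
  integral_map Measurable.of_discrete.aemeasurable
    (Measurable.aestronglyMeasurable (by fun_prop))

theorem cos_pi_div_two_mul_sign {A : ℝ} (hA : A ≠ 0) :
    Real.cos (Real.pi / 2 * Real.sign A) = 0 := by
  rcases lt_or_gt_of_ne hA with h | h
  · rw [Real.sign_of_neg h, mul_neg_one, Real.cos_neg, Real.cos_pi_div_two]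
  · rw [Real.sign_of_pos h, mul_one, Real.cos_pi_div_two]

theorem abs_mul_sin_pi_div_two_mul_sign (A : ℝ) :
    |A| * Real.sin (Real.pi / 2 * Real.sign A) = A := by
  rcases lt_trichotomy A 0 with h | h | h
  · rw [Real.sign_of_neg h, abs_of_neg h, mul_neg_one, Real.sin_neg, Real.sin_pi_div_two]
    ring
  · simp [h]
  · rw [Real.sign_of_pos h, abs_of_pos h, mul_one, Real.sin_pi_div_two, mul_one]

/-- With $\theta=\mathrm{sgn}\,A$ the cosine part of the exponent vanishes and
$|A|(i^\theta\varphi)=iA\varphi$, the first-order Taylor term. -/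
theorem stepExpansion_of_mean_ne_zero {W : PMF ℤ} {A : ℝ}
    (hi : Integrable (fun x : ℤ => (x : ℝ)) W.toMeasure)
    (hA : ∫ x : ℤ, (x : ℝ) ∂W.toMeasure = A) (hA0 : A ≠ 0) :
    StepExpansion W 1 (Real.sign A) |A| := by
  have hm : MemLp id (1 : ℕ) (stepLaw W) := by
    rw [Nat.cast_one, memLp_one_iff_integrable, stepLaw,
      integrable_map_measure (by fun_prop) Measurable.of_discrete.aemeasurable]
    exact hi
  have h := stepCharFun_taylor hm
  refine (h.congr_left fun φ => ?_).congr_right fun φ => ?_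
  · have h1 : ∫ x : ℝ, x ^ 1 ∂(stepLaw W) = A := by
      rw [integral_stepLaw]; simpa using hA
    have h2 : (((|A| * (|φ| * Real.sign φ * Real.sin (Real.pi / 2 * Real.sign A)) : ℝ)) : ℂ) =
        ((A * φ : ℝ) : ℂ) := by
      congr 1
      have h3 : |φ| * Real.sign φ = φ := by
        rcases lt_trichotomy φ 0 with hk | hk | hk
        · rw [Real.sign_of_neg hk, abs_of_neg hk]; ring
        · simp [hk]
        · rw [Real.sign_of_pos hk, abs_of_pos hk]; ring
      rw [h3, mul_left_comm, abs_mul_sin_pi_div_two_mul_sign, mul_comm]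
    have h5 : ((|A| : ℝ) : ℂ) * stableExponent 1 (Real.sign A) φ = Complex.I * (A * φ) := by
      rw [stableExponent_eq one_pos, mul_one, cos_pi_div_two_mul_sign hA0, Real.rpow_one,
        mul_zero, Complex.ofReal_zero,
        zero_add, mul_left_comm, ← Complex.ofReal_mul, h2, Complex.ofReal_mul]
    rw [h5, Finset.sum_range_succ, Finset.sum_range_one, h1]
    simp
    ring
  · simp

theorem stableExponent_two_zero (k : ℝ) : stableExponent 2 0 k = (k : ℂ) ^ 2 := by
  rw [stableExponent_eq two_pos, mul_zero, Real.cos_zero, Real.sin_zero, Real.rpow_two, sq_abs]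
  simp

theorem stepExpansion_of_mean_eq_zero {W : PMF ℤ} {B : ℝ}
    (hi : Integrable (fun x : ℤ => (x : ℝ) ^ 2) W.toMeasure)
    (hA : ∫ x : ℤ, (x : ℝ) ∂W.toMeasure = 0)
    (hB : ∫ x : ℤ, (x : ℝ) ^ 2 ∂W.toMeasure = B) : StepExpansion W 2 0 (B / 2) := by
  have hm : MemLp id (2 : ℕ) (stepLaw W) := by
    rw [Nat.cast_ofNat, memLp_two_iff_integrable_sq (by fun_prop), stepLaw,
      integrable_map_measure (by fun_prop) Measurable.of_discrete.aemeasurable]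
    exact hi
  have h := stepCharFun_taylor hm
  refine (h.congr_left fun φ => ?_).congr_right fun φ => ?_
  · have h1 : ∫ x : ℝ, x ^ 1 ∂(stepLaw W) = 0 := by
      rw [integral_stepLaw]; simpa using hA
    have h2 : ∫ x : ℝ, x ^ 2 ∂(stepLaw W) = B := by rw [integral_stepLaw, hB]
    rw [stableExponent_two_zero, Finset.sum_range_succ, Finset.sum_range_succ,
      Finset.sum_range_one, h1, h2]
    simp [mul_pow]
    ring
  · simp

/-! ## The Laplace law -/

theorem stableDensity_two {B : ℝ} (hB : 0 < B) (y : ℝ) :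
    stableDensity 2 0 (B / 2) y = 1 / √(2 * Real.pi * B) * Real.exp (-(y ^ 2 / (2 * B))) := by
  have hv : B.toNNReal ≠ 0 := by simpa using hB
  have h := fourierDensity_gaussian hv y
  rw [Real.coe_toNNReal B hB.le] at h
  have h1 : stableDensity 2 0 (B / 2) y = (fourierDensity (fun k =>
      Complex.exp (-(B / 2 : ℝ) * (k : ℂ) ^ 2)) y).re := by
    rw [stableDensity, fourierDensity]
    simp_rw [stableExponent_two_zero, neg_mul]
  rw [h1, h, Complex.ofReal_re, gaussianPDFReal, Real.coe_toNNReal B hB.le, sub_zero, one_div,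
    neg_div]

theorem continuous_laplaceDensity (B : ℝ) : Continuous (laplaceDensity B) := by
  unfold laplaceDensity; fun_prop

/-- With $b=\sqrt{2/B}$ the two half-lines contribute $1/(b\pm ik)$ up to the factor $1/(Bb)$, and
their sum is a multiple of $1/(b^2+k^2)$. -/
theorem integral_cexp_mul_laplaceDensity {B : ℝ} (hB : 0 < B) :
    Integrable (laplaceDensity B) ∧ ∀ k : ℝ,
    ∫ y : ℝ, Complex.exp (-(Complex.I * k * y)) * (laplaceDensity B y : ℂ) =
      1 / (1 + ((B / 2 : ℝ) : ℂ) * stableExponent 2 0 k) := by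
  set b := √(2 / B) with hb
  have hb0 : 0 < b := Real.sqrt_pos.2 (by positivity)
  have hbsq : b ^ 2 = 2 / B := Real.sq_sqrt (by positivity)
  have hB2 : √(2 * B) = B * b := by
    rw [hb, ← Real.sqrt_sq hB.le, ← Real.sqrt_mul (by positivity), Real.sqrt_sq hB.le]
    congr 1; field_simp
  have hi : Integrable (laplaceDensity B) := by
    refine (integrable_comp_abs (f := fun y => Real.exp (-b * y)) ?_).div_const (√(2 * B)) |>.congr
      (ae_of_all _ fun y => ?_)
    · exact exp_neg_integrableOn_Ioi 0 hb0
    · simp only [laplaceDensity]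
      rw [neg_mul, mul_comm b]
  refine ⟨hi, fun k => ?_⟩
  have hre : ∀ k : ℝ, 0 < ((b : ℂ) + Complex.I * k).re := fun k => by simpa using hb0
  have hne : ∀ k : ℝ, (b : ℂ) + Complex.I * k ≠ 0 := fun k h => by
    have := hre k; rw [h] at this; simp at this
  have hhalf : ∀ k : ℝ, ∫ y in Set.Ioi (0 : ℝ),
      Complex.exp (-(Complex.I * k * y)) * (laplaceDensity B y : ℂ) =
      1 / ((B * b : ℝ) : ℂ) * (1 / (b + Complex.I * k)) := fun k => by
    rw [← integral_cexp_neg_mul_Ioi (hre k), ← integral_const_mul]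
    refine setIntegral_congr_fun measurableSet_Ioi fun y hy => ?_
    have hy' : 0 < y := hy
    simp only [laplaceDensity]
    rw [abs_of_pos hy', hB2, Complex.ofReal_div, Complex.ofReal_exp, mul_div_assoc',
      ← Complex.exp_add, one_div, inv_mul_eq_div]
    congr 2
    push_cast; ring
  have hint : Integrable fun y : ℝ =>
      Complex.exp (-(Complex.I * k * y)) * (laplaceDensity B y : ℂ) := by
    have := integrable_cexp_mul (φ := fun y => (laplaceDensity B y : ℂ)) hi.ofReal (-k)
    refine this.congr (ae_of_all _ fun y => ?_)
    simp only
    congr 2; push_cast; ring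
  have hneg : ∫ y in Set.Iic (0 : ℝ),
      Complex.exp (-(Complex.I * k * y)) * (laplaceDensity B y : ℂ) =
      1 / ((B * b : ℝ) : ℂ) * (1 / (b + Complex.I * (-k : ℝ))) := by
    rw [← hhalf (-k)]
    have h := integral_comp_neg_Iic 0 fun y : ℝ =>
      Complex.exp (-(Complex.I * (-k : ℝ) * y)) * (laplaceDensity B y : ℂ)
    rw [neg_zero] at h
    rw [← h]
    refine integral_congr_ae (ae_of_all _ fun y => ?_)
    simp only [laplaceDensity, abs_neg]
    congr 2; push_cast; ring
  rw [← intervalIntegral.integral_Iic_add_Ioi (b := 0) hint.integrableOn hint.integrableOn, hneg,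
    hhalf k, stableExponent_two_zero]
  have h1 := hne k
  have h2 := hne (-k)
  have h3 : ((b : ℂ) + Complex.I * k) * (b + Complex.I * (-k : ℝ)) = 2 / B + k ^ 2 := by
    have : (b : ℂ) ^ 2 = 2 / B := by exact_mod_cast hbsq
    push_cast
    linear_combination this - (k : ℂ) ^ 2 * Complex.I_sq
  have h4 : 1 / ((b : ℂ) + Complex.I * (-k : ℝ)) + 1 / (b + Complex.I * k) =
      2 * b / (2 / B + k ^ 2) := by
    rw [← h3, div_add_div _ _ h2 h1]
    congr 1
    · push_cast; ring
    · ring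
  have hBc : (B : ℂ) ≠ 0 := by exact_mod_cast hB.ne'
  have hbc : (b : ℂ) ≠ 0 := by exact_mod_cast hb0.ne'
  have h5 : (2 / B + k ^ 2 : ℂ) ≠ 0 := by rw [← h3]; exact mul_ne_zero h1 h2
  have h6 : (2 + B * k ^ 2 : ℂ) ≠ 0 := by
    intro h; apply h5; field_simp; rw [mul_zero]; exact h
  rw [← mul_add, h4]
  have h7 : (1 + ((B / 2 : ℝ) : ℂ) * (k : ℂ) ^ 2) = (2 + B * k ^ 2) / 2 := by push_cast; ring
  have h8 : (2 / B + k ^ 2 : ℂ) = (2 + B * k ^ 2) / B := by field_simp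
  rw [h7, h8]
  push_cast
  field_simp

/-- Both sides are the inverse transform of $1/(1+Bk^2/2)$, so the $\tau$-integral is never computed
directly. The walk serves to provide the stable law behind the Fourier formula for the mixture. -/
theorem nessDensity_two {W : PMF ℤ} {B : ℝ} (hB : 0 < B) (hW : StepExpansion W 2 0 (B / 2))
    (y : ℝ) : nessDensity 2 (stableDensity 2 0 (B / 2)) y = laplaceDensity B y := by
  obtain ⟨ν, hν, h⟩ := exists_hasStableCharFun two_pos hW
  have hcos : 0 < Real.cos (Real.pi / 2 * 2 * 0) := by simp
  obtain ⟨hi, hI⟩ := integral_cexp_mul_laplaceDensity hB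
  have h1 := h.nessDensity_eq one_lt_two (half_pos hB) hcos y
  have h2 := fourierDensity_of_integral_eq (f := fun y => (laplaceDensity B y : ℂ))
    (Complex.continuous_ofReal.comp (continuous_laplaceDensity B)) hi.ofReal
    (integrable_inv_one_add_stableExponent one_lt_two (half_pos hB) hcos) hI
  rw [h2] at h1
  exact Complex.ofReal_injective h1

/-! ### Normalization and the limit laws in the special cases -/

theorem hasSum_infinitePropagator_one (ψ : PMF ℕ) (W : PMF ℤ) {p : ℝ} (hp : 0 < p) (hp1 : p < 1) :
    HasSum (infinitePropagator ψ W p) 1 := by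
  have := isProbabilityMeasure_finalLaw ψ W hp hp1
  simpa using hasSum_infinitePropagator ψ W hp hp1 (f := fun _ => 1) (C := 1) (by simp)

theorem HasStableCharFun.nessLaw_of_cos_eq_zero {θ c : ℝ} {ν : Measure ℝ} [IsProbabilityMeasure ν]
    (hc : 0 < c) (hν : HasStableCharFun 1 θ c ν) (h : Real.cos (Real.pi / 2 * θ) = 0) :
    nessLaw 1 ν = lawOfDensity (exponentialDensity (c * Real.sin (Real.pi / 2 * θ))) := by
  have hs : Real.sin (Real.pi / 2 * θ) ≠ 0 := fun h0 => by
    simpa [h, h0] using Real.sin_sq_add_cos_sq (Real.pi / 2 * θ)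
  rw [hν.eq_dirac h, nessLaw_dirac (mul_ne_zero hc.ne' hs)]

theorem convergesToNESS_of_mean_ne_zero {W : PMF ℤ} {A : ℝ} (hA : A ≠ 0)
    (hW : StepExpansion W 1 (Real.sign A) |A|) :
    ConvergesToNESS W 1 (lawOfDensity (exponentialDensity A)) := by
  obtain ⟨ν, hν, h⟩ := exists_hasStableCharFun one_pos hW
  have hc := h.convergesToNESS one_pos (abs_pos.2 hA) hW
  rw [h.nessLaw_of_cos_eq_zero (abs_pos.2 hA) (cos_pi_div_two_mul_sign hA)] at hc
  rwa [abs_mul_sin_pi_div_two_mul_sign] at hc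

theorem convergesToNESS_of_mean_eq_zero {W : PMF ℤ} {B : ℝ} (hB : 0 < B)
    (hW : StepExpansion W 2 0 (B / 2)) :
    ConvergesToNESS W 2 (lawOfDensity (laplaceDensity B)) := by
  obtain ⟨ν, hν, h⟩ := exists_hasStableCharFun two_pos hW
  have hc := h.convergesToNESS two_pos (half_pos hB) hW
  rwa [h.nessLaw_eq two_pos (half_pos hB) (by simp), funext (nessDensity_two hB hW)] at hc

end StoppedWalk

theorem mainTheorem8 (W : PMF ℤ) :
    -- the infinite-time propagator exists, is a probability distribution, and is expressed by `P_q`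
    (∀ ψ : PMF ℕ, ψ 0 = 0 → ∀ p : ℝ, 0 < p → p < 1 →
      (∀ x : ℤ, Tendsto (fun t : ℕ => propagator ψ W p t x) atTop
        (𝓝 (infinitePropagator ψ W p x))) ∧
      (∀ x : ℤ, 0 ≤ infinitePropagator ψ W p x) ∧
      HasSum (infinitePropagator ψ W p) 1 ∧
      ∀ x : ℤ, (infinitePropagator ψ W p x : ℂ) =
        1 / ((1 - p : ℝ) : ℂ) * auxPropagator ψ W p x
          - (p : ℂ) / ((1 - p : ℝ) : ℂ) * (if x = 0 then 1 else 0)) ∧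
    -- the steady state for steps in the class of index `α`
    (∀ α θ c : ℝ, 0 < α → α ≤ 2 → 0 < c → StepExpansion W α θ c →
      ∃ ν : Measure ℝ, IsProbabilityMeasure ν ∧
        (∀ k : ℝ, charFun ν (-k) = Complex.exp (-((c : ℂ) * stableExponent α θ k))) ∧
        IsStable α ν ∧
        ConvergesToNESS W α (nessLaw α ν) ∧
        -- all cases but the degenerate one: densities
        (¬ (α = 1 ∧ Real.cos (Real.pi / 2 * θ) = 0) →
          (∀ y, 0 ≤ stableDensity α θ c y) ∧
          ν = lawOfDensity (stableDensity α θ c) ∧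
          (∀ y, y ≠ 0 ∨ 1 < α → IntegrableOn
            (fun τ => Real.exp (-τ) * τ ^ (-(1 / α)) *
              stableDensity α θ c (y * τ ^ (-(1 / α)))) (Set.Ioi 0)) ∧
          nessLaw α ν = lawOfDensity (nessDensity α (stableDensity α θ c)) ∧
          (1 < α → AddSubgroup.closure W.support = ⊤ →
            ConvergesLocally W α (nessDensity α (stableDensity α θ c)))) ∧
        -- the degenerate case `L_1 = δ(y - A)`
        ((α = 1 ∧ Real.cos (Real.pi / 2 * θ) = 0) →
          ν = Measure.dirac (c * Real.sin (Real.pi / 2 * θ)) ∧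
          nessLaw α ν =
            lawOfDensity (exponentialDensity (c * Real.sin (Real.pi / 2 * θ))))) ∧
    -- biased steps with finite mean: one-sided exponential law
    (∀ A : ℝ, Integrable (fun x : ℤ => (x : ℝ)) W.toMeasure →
      ∫ x : ℤ, (x : ℝ) ∂W.toMeasure = A → A ≠ 0 →
        StepExpansion W 1 (Real.sign A) |A| ∧
        ConvergesToNESS W 1 (lawOfDensity (exponentialDensity A))) ∧
    -- unbiased steps with finite variance: Laplace law
    (∀ B : ℝ, Integrable (fun x : ℤ => (x : ℝ) ^ 2) W.toMeasure →
      ∫ x : ℤ, (x : ℝ) ∂W.toMeasure = 0 → ∫ x : ℤ, (x : ℝ) ^ 2 ∂W.toMeasure = B → 0 < B →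
        StepExpansion W 2 0 (B / 2) ∧
        (∀ y, stableDensity 2 0 (B / 2) y
          = 1 / √(2 * Real.pi * B) * Real.exp (-(y ^ 2 / (2 * B)))) ∧
        (∀ y, nessDensity 2 (stableDensity 2 0 (B / 2)) y = laplaceDensity B y) ∧
        ConvergesToNESS W 2 (lawOfDensity (laplaceDensity B))) := by
  refine ⟨fun ψ hψ p hp hp1 => ⟨fun x => ?_, infinitePropagator_nonneg ψ W hp hp1,
    hasSum_infinitePropagator_one ψ W hp hp1, infinitePropagator_eq_auxPropagator hψ W hp hp1⟩,
    fun α θ c hα _ hc hW => ?_, fun A hi hA hA0 => ?_, fun B hi hA hB hB0 => ?_⟩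
  · rw [infinitePropagator_eq ψ W hp hp1]
    exact tendsto_propagator ψ W hp hp1 x
  · obtain ⟨ν, hν, h⟩ := exists_hasStableCharFun hα hW
    refine ⟨ν, hν, h, h.isStable hα, h.convergesToNESS hα hc hW, fun hne => ?_, ?_⟩
    · have hcos := h.cos_pos hα hc hne
      exact ⟨h.stableDensity_nonneg hα hc hcos, h.eq_lawOfDensity hα hc hcos,
        fun y hy => integrableOn_nessDensity_integrand hα (h.continuous_stableDensity hα hc hcos)
          (h.integrable_stableDensity hα hc hcos) h.abs_stableDensity_le hy,
        h.nessLaw_eq hα hc hcos, fun hα1 => h.convergesLocally hα1 hc hW hcos⟩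
    · rintro ⟨rfl, h0⟩
      exact ⟨h.eq_dirac h0, h.nessLaw_of_cos_eq_zero hc h0⟩
  · have hW := stepExpansion_of_mean_ne_zero hi hA hA0
    exact ⟨hW, convergesToNESS_of_mean_ne_zero hA0 hW⟩
  · have hW := stepExpansion_of_mean_eq_zero hi hA hB
    exact ⟨hW, stableDensity_two hB0, nessDensity_two hB0 hW,
      convergesToNESS_of_mean_eq_zero hB0 hW⟩
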